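/- For metric spaces $X,Y$ and a map $f\colon X\to Y$, let $\alpha,\beta\in[0,\infty]$ be the largest and the smallest constant, respectively, with $\alpha\, d_X(x,x')\le d_Y(f(x),f(x'))\le\beta\, d_X(x,x')$ for all $x,x'\in X$, and put $\kappa(f):=\beta/\alpha$, with $\kappa(f)=\infty$ if $\alpha=0$ or $\beta=\infty$. The Euclidean distortion $c_2(X)$ is the infimum of $\kappa(f)$ over all maps $f$ from $X$ to a Hilbert space. If a group $G$ acts on $X$ by isometries with closed orbits, then $X/G$ carries the quotient metric $d([x],[y])=\inf_{p\in[x],\,q\in[y]}d_X(p,q)$. **Theorem.** Let $V$ be a finite-dimensional real inner product space, let $R\le\operatorname{O}(V)$ be a finite group generated by reflections in hyperplanes, and let $R^+:=R\cap\operatorname{SO}(V)$. Then $$c_2(V/R^+)\le 2 .$$ Suppose moreover that $R$ is nontrivial. Let $C\subseteq V$ be any closed Weyl chamber of $R$, let $s_1,\dots,s_m\in R$ be the reflections in the hyperplanes spanned by the facets of $C$, and let $n$ be the largest entry of the Coxeter matrix $\big(\operatorname{ord}(s_is_j)\big)_{i,j=1}^m$. Then: 1. $n\sin\!\big(\tfrac{\pi}{2n}\big)\le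 c_2(V/R^+)$; 2. if $|R|>2$, then $n\sin\!\big(\tfrac{\pi}{2n}\big)\ge\sqrt2$; 3. if $|R|>2$ and $R$ is irreducible as a reflection group (that is, the Coxeter graph on $\{1,\dots,m\}$, in which $i\ne j$ are joined when $\operatorname{ord}(s_is_j)\neq 2$, is connected), then $n\sin\!\big(\tfrac{\pi}{2n}\big)\ge\tfrac32$; 4. $V/R^+$ is isometric to the space $C\sqcup_{\partial C}C$ obtained by gluing two copies of $C$ along the boundary $\partial C$ of $C$ in $V$, where points $y,y'$ have distance $\|y-y'\|$ if they lie in the same copy and $\inf_{z\in\partial C}\big(\|y-z\|+\|z-y'\|\big)$ if they lie in different copies. -/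

import Mathlib

open scoped ENNReal

noncomputable section

universe u v w

/-! ### Distortion of maps and Euclidean distortion of metric spaces -/

/-- The optimal lower Lipschitz bound of `f`: the largest `a ∈ [0, ∞]` with
`a * d(x, y) ≤ d(f x, f y)` for all `x, y`. -/
def lowerLipschitzBound {X : Type u} {Y : Type v} [PseudoMetricSpace X] [PseudoMetricSpace Y]
    (f : X → Y) : ℝ≥0∞ :=
  sSup {a : ℝ≥0∞ | ∀ x y, a * edist x y ≤ edist (f x) (f y)}

/-- The optimal upper Lipschitz bound of `f`: the smallest `b ∈ [0, ∞]` with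
`d(f x, f y) ≤ b * d(x, y)` for all `x, y`. -/
def upperLipschitzBound {X : Type u} {Y : Type v} [PseudoMetricSpace X] [PseudoMetricSpace Y]
    (f : X → Y) : ℝ≥0∞ :=
  sInf {b : ℝ≥0∞ | ∀ x y, edist (f x) (f y) ≤ b * edist x y}

open Classical in
/-- The distortion of `f`: the quotient of its optimal upper and lower Lipschitz bounds, and `∞`
if the lower bound is `0` or the upper bound is `∞`. -/
def distortion {X : Type u} {Y : Type v} [PseudoMetricSpace X] [PseudoMetricSpace Y]
    (f : X → Y) : ℝ≥0∞ :=
  if lowerLipschitzBound f = 0 ∨ upperLipschitzBound f = ∞ then ∞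
  else upperLipschitzBound f / lowerLipschitzBound f

/-- The Euclidean distortion `c₂(X)`: the infimum of the distortions of all maps from `X` into
(real) Hilbert spaces. Hilbert spaces in the universe of `X` suffice, because the closed linear
span of the image of `X` is isometric to some `ℓ²(ι)` with `ι` in that universe. -/
def euclideanDistortion (X : Type u) [PseudoMetricSpace X] : ℝ≥0∞ :=
  ⨅ (H : Type u) (_ : NormedAddCommGroup H) (_ : InnerProductSpace ℝ H) (_ : CompleteSpace H)
    (f : X → H), distortion f

/-! ### Orbit spaces -/

/-- The orbit space `X/G`, as a type of its own, which carries the quotient metric. -/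
def OrbitSpace (G : Type v) (X : Type u) [Group G] [MulAction G X] : Type u :=
  MulAction.orbitRel.Quotient G X

namespace OrbitSpace

variable {G : Type v} {X : Type u} [Group G] [MulAction G X]

/-- The orbit of a point, as a point of the orbit space. -/
def mk (G : Type v) {X : Type u} [Group G] [MulAction G X] (x : X) : OrbitSpace G X :=
  (Quotient.mk _ x : MulAction.orbitRel.Quotient G X)

/-- The orbit that a point of the orbit space stands for, as a subset of `X`. -/
def orbit (a : OrbitSpace G X) : Set X :=
  MulAction.orbitRel.Quotient.orbit a

theorem orbit_mk (x : X) : (mk G x).orbit = MulAction.orbit G x :=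
  MulAction.orbitRel.Quotient.orbit_mk x

theorem nonempty_orbit (a : OrbitSpace G X) : a.orbit.Nonempty := by
  induction a using Quotient.inductionOn' with
  | h x => exact ⟨x, MulAction.mem_orbit_self x⟩

theorem exists_smul_eq_of_mem_orbit {a : OrbitSpace G X} {p q : X} (hp : p ∈ a.orbit)
    (hq : q ∈ a.orbit) : ∃ g : G, g • p = q := by
  induction a using Quotient.inductionOn' with
  | h x =>
    obtain ⟨g, rfl⟩ : ∃ g : G, g • x = p := hp
    obtain ⟨h, rfl⟩ : ∃ h : G, h • x = q := hq
    exact ⟨h * g⁻¹, by rw [mul_smul, inv_smul_smul]⟩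

theorem smul_mem_orbit {a : OrbitSpace G X} {p : X} (hp : p ∈ a.orbit) (g : G) :
    g • p ∈ a.orbit := by
  induction a using Quotient.inductionOn' with
  | h x =>
    obtain ⟨h, rfl⟩ : ∃ h : G, h • x = p := hp
    exact ⟨g * h, mul_smul g h x⟩

/-- The quotient (pseudo)metric: `d([x], [y])` is the infimum of `d(p, q)` over `p ∈ [x]` and
`q ∈ [y]`. -/
instance [PseudoMetricSpace X] : Dist (OrbitSpace G X) :=
  ⟨fun a b => ⨅ pq : a.orbit × b.orbit, dist (pq.1 : X) (pq.2 : X)⟩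

theorem dist_def [PseudoMetricSpace X] (a b : OrbitSpace G X) :
    dist a b = ⨅ pq : a.orbit × b.orbit, dist (pq.1 : X) (pq.2 : X) := rfl

theorem dist_le [PseudoMetricSpace X] {a b : OrbitSpace G X} {p q : X} (hp : p ∈ a.orbit)
    (hq : q ∈ b.orbit) : dist a b ≤ dist p q :=
  ciInf_le (f := fun pq : a.orbit × b.orbit => dist (pq.1 : X) (pq.2 : X))
    ⟨0, by rintro _ ⟨pq, rfl⟩; exact dist_nonneg⟩ (⟨p, hp⟩, ⟨q, hq⟩)

theorem exists_dist_lt [PseudoMetricSpace X] (a b : OrbitSpace G X) {ε : ℝ} (hε : 0 < ε) :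
    ∃ p ∈ a.orbit, ∃ q ∈ b.orbit, dist p q < dist a b + ε := by
  have : Nonempty (a.orbit × b.orbit) :=
    ⟨(⟨_, a.nonempty_orbit.some_mem⟩, ⟨_, b.nonempty_orbit.some_mem⟩)⟩
  obtain ⟨⟨p, q⟩, h⟩ := exists_lt_of_ciInf_lt
    (show (⨅ pq : a.orbit × b.orbit, dist (pq.1 : X) (pq.2 : X)) < dist a b + ε by
      rw [← dist_def]; linarith)
  exact ⟨p, p.2, q, q.2, h⟩

instance [PseudoMetricSpace X] [IsIsometricSMul G X] : PseudoMetricSpace (OrbitSpace G X) where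
  dist_self a := by
    obtain ⟨p, hp⟩ := a.nonempty_orbit
    refine le_antisymm ((dist_le hp hp).trans_eq (dist_self p)) ?_
    exact Real.iInf_nonneg fun _ => dist_nonneg
  dist_comm a b := by
    have key : ∀ a b : OrbitSpace G X, dist a b ≤ dist b a := fun a b => by
      refine le_of_forall_pos_le_add fun ε hε => ?_
      obtain ⟨p, hp, q, hq, h⟩ := exists_dist_lt b a hε
      exact ((dist_le hq hp).trans_eq (dist_comm q p)).trans h.le
    exact le_antisymm (key a b) (key b a)
  dist_triangle a b c := by
    refine le_of_forall_pos_le_add fun ε hε => ?_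
    obtain ⟨p, hp, q, hq, h₁⟩ := exists_dist_lt a b (half_pos hε)
    obtain ⟨q', hq', r, hr, h₂⟩ := exists_dist_lt b c (half_pos hε)
    obtain ⟨g, rfl⟩ := exists_smul_eq_of_mem_orbit hq' hq
    have h₃ := dist_le hp (smul_mem_orbit hr g)
    have h₄ := dist_triangle p (g • q') (g • r)
    rw [dist_smul] at h₄
    linarith

end OrbitSpace

/-! ### Gluing two copies of a metric space -/

/-- The metric space `Y ⊔_Z Y` obtained by gluing two copies of `Y` along the nonempty subset `Z`:
the distance between points of the same copy is that of `Y`, and points `y`, `y'` of different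
copies have distance `⨅ z ∈ Z, d(y, z) + d(z, y')`. -/
abbrev GluedDouble {Y : Type u} [MetricSpace Y] (Z : Set Y) [Nonempty Z] : Type u :=
  Metric.GlueSpace (isometry_subtype_coe : Isometry (Subtype.val : Z → Y))
    (isometry_subtype_coe : Isometry (Subtype.val : Z → Y))

/-! ### Linear isometries, reflection groups, Weyl chambers -/

variable {V : Type u} [NormedAddCommGroup V] [InnerProductSpace ℝ V]

/-- The tautological action of `O(V)` on `V`. -/
instance LinearIsometryEquiv.tautologicalMulAction : MulAction (V ≃ₗᵢ[ℝ] V) V where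
  smul g v := g v
  one_smul _ := rfl
  mul_smul _ _ _ := rfl

theorem LinearIsometryEquiv.tautological_smul_def (g : V ≃ₗᵢ[ℝ] V) (v : V) : g • v = g v := rfl

instance LinearIsometryEquiv.tautologicalIsIsometricSMul :
    IsIsometricSMul (V ≃ₗᵢ[ℝ] V) V where
  isometry_smul g := g.isometry

/-- A subgroup of `O(V)` acts on `V` by isometries. -/
instance Subgroup.tautologicalIsIsometricSMul (G : Subgroup (V ≃ₗᵢ[ℝ] V)) :
    IsIsometricSMul G V where
  isometry_smul g := (g : V ≃ₗᵢ[ℝ] V).isometry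

variable (V) in
/-- `SO(V)`, as a subgroup of `O(V)`. -/
def specialOrthogonalSubgroup : Subgroup (V ≃ₗᵢ[ℝ] V) where
  carrier := {g | LinearMap.det (g.toLinearEquiv : V →ₗ[ℝ] V) = 1}
  one_mem' := LinearMap.det_id
  mul_mem' {a b} ha hb := by
    change LinearMap.det
      ((a.toLinearEquiv : V →ₗ[ℝ] V) ∘ₗ (b.toLinearEquiv : V →ₗ[ℝ] V)) = 1
    rw [LinearMap.det_comp, ha, hb, mul_one]
  inv_mem' {a} ha := by
    have h := LinearEquiv.det_symm_mul_det a.toLinearEquiv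
    rw [ha, mul_one] at h
    exact h

/-- The alternating subgroup `R⁺ = R ∩ SO(V)`. -/
def alternatingSubgroup (R : Subgroup (V ≃ₗᵢ[ℝ] V)) : Subgroup (V ≃ₗᵢ[ℝ] V) :=
  R ⊓ specialOrthogonalSubgroup V

/-- The reflection `v ↦ v - 2 ⟪v, α⟫ / ‖α‖² • α` in the hyperplane orthogonal to `α ≠ 0`. -/
def hyperplaneReflection (α : V) : V ≃ₗᵢ[ℝ] V :=
  (ℝ ∙ α)ᗮ.reflection

/-- The unit normals of the reflecting hyperplanes of `R`. -/
def unitRoots (R : Subgroup (V ≃ₗᵢ[ℝ] V)) : Set V :=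
  {α | ‖α‖ = 1 ∧ hyperplaneReflection α ∈ R}

/-- `R` is generated by reflections. -/
def IsReflectionGroup (R : Subgroup (V ≃ₗᵢ[ℝ] V)) : Prop :=
  Subgroup.closure (hyperplaneReflection '' unitRoots R) = R

/-- A closed Weyl chamber of `R`: the set of all `v` that lie, for each reflecting hyperplane of
`R`, on the same closed side of it as some fixed point `x` that is on none of these hyperplanes. -/
structure WeylChamber (R : Subgroup (V ≃ₗᵢ[ℝ] V)) where
  carrier : Set V
  exists_regular : ∃ x : V, (∀ α ∈ unitRoots R, inner ℝ α x ≠ 0) ∧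
    carrier = {v | ∀ α ∈ unitRoots R, 0 ≤ inner ℝ α x * inner ℝ α v}

namespace WeylChamber

variable {R : Subgroup (V ≃ₗᵢ[ℝ] V)} (C : WeylChamber R)

/-- The unit vectors that are orthogonal to the facets of `C` and point into `C`. A face
`C ∩ αᗮ` is a facet when it spans the hyperplane `αᗮ`. -/
def simpleRoots : Set V :=
  {α | α ∈ unitRoots R ∧ (∀ v ∈ C.carrier, 0 ≤ inner ℝ α v) ∧
    Submodule.span ℝ (C.carrier ∩ ((ℝ ∙ α)ᗮ : Submodule ℝ V)) = (ℝ ∙ α)ᗮ}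

theorem hyperplaneReflection_injOn_simpleRoots :
    Set.InjOn hyperplaneReflection C.simpleRoots := by
  intro α hα β hβ h
  obtain ⟨x, hx, hC⟩ := C.exists_regular
  have hxC : x ∈ C.carrier := by
    rw [hC]; exact fun γ _ => mul_self_nonneg _
  have hα1 : ‖α‖ = 1 := hα.1.1
  have hβ1 : ‖β‖ = 1 := hβ.1.1
  have h₁ : hyperplaneReflection β α = -α := by
    rw [← h]; exact Submodule.reflection_orthogonalComplement_singleton_eq_neg α
  have h₂ : hyperplaneReflection β α = -(2 • (inner ℝ β α / ‖β‖ ^ 2) • β - α) := by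
    rw [hyperplaneReflection, Submodule.reflection_orthogonal_apply,
      Submodule.reflection_singleton_apply]
    rfl
  set c : ℝ := inner ℝ β α with hc
  have h₃ : α = c • β := by
    rw [h₁, hβ1] at h₂
    have h₄ : α = 2 • (c / 1 ^ 2) • β - α := neg_injective h₂
    have h₅ : (2 : ℝ) • α = (2 : ℝ) • (c • β) := by
      rw [two_smul]
      nth_rewrite 1 [h₄]
      simp [two_smul]
    exact smul_right_injective V (two_ne_zero (α := ℝ)) h₅
  have hpα : 0 < inner ℝ α x := lt_of_le_of_ne (hα.2.1 x hxC) (hx α hα.1).symm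
  have hpβ : 0 < inner ℝ β x := lt_of_le_of_ne (hβ.2.1 x hxC) (hx β hβ.1).symm
  have hc0 : 0 < c := by
    rw [h₃, real_inner_smul_left] at hpα
    exact pos_of_mul_pos_left hpα hpβ.le
  have hc1 : c = 1 := by
    have h₆ := congrArg norm h₃
    rw [norm_smul, hα1, hβ1, mul_one, Real.norm_eq_abs, abs_of_pos hc0] at h₆
    exact h₆.symm
  rw [h₃, hc1, one_smul]

/-- The Coxeter matrix of `R` relative to the chamber `C`: its rows and columns are indexed by the
facets of `C`, and its entries are the orders of the products of two reflections in facets. -/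
def coxeterMatrix : CoxeterMatrix C.simpleRoots where
  M := Matrix.of fun α β =>
    orderOf (hyperplaneReflection (α : V) * hyperplaneReflection (β : V))
  isSymm := by
    ext α β
    simp only [Matrix.transpose_apply, Matrix.of_apply]
    rw [← orderOf_inv, mul_inv_rev]
    simp only [hyperplaneReflection, Submodule.reflection_inv]
  diagonal α := by
    simp only [Matrix.of_apply, hyperplaneReflection, Submodule.reflection_mul_reflection,
      orderOf_one]
  off_diagonal α β hαβ := by
    simp only [Matrix.of_apply, ne_eq, orderOf_eq_one_iff]
    intro h
    refine hαβ (Subtype.ext (C.hyperplaneReflection_injOn_simpleRoots α.2 β.2 ?_))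
    rw [mul_eq_one_iff_eq_inv] at h
    rw [h]
    exact Submodule.reflection_inv

/-- The Coxeter graph: two distinct simple roots are joined when their entry in the Coxeter matrix
is not `2`, that is, when the two reflections do not commute. -/
def coxeterGraph : SimpleGraph C.simpleRoots where
  Adj α β := α ≠ β ∧ C.coxeterMatrix α β ≠ 2
  symm := ⟨fun α β h => ⟨h.1.symm, by rw [C.coxeterMatrix.symmetric]; exact h.2⟩⟩
  loopless := ⟨fun _ h => h.1 rfl⟩

/-- `R` is irreducible as a reflection group: its Coxeter graph is (nonempty and) connected. -/
def IsIrreducible : Prop := C.coxeterGraph.Connected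

/-- `n` is the largest entry of the Coxeter matrix. -/
def IsLargestCoxeterEntry (n : ℕ) : Prop :=
  IsGreatest {m | ∃ α β, C.coxeterMatrix α β = m} n

/-- The boundary of the chamber, as a subset of the chamber. -/
def boundary : Set C.carrier :=
  {c | (c : V) ∈ frontier C.carrier}

end WeylChamber

/-- Every finite subgroup of `O(V)` has a Weyl chamber. -/
instance WeylChamber.instNonempty (R : Subgroup (V ≃ₗᵢ[ℝ] V)) [Finite R] :
    Nonempty (WeylChamber R) := by
  let ι := {g : R // ∃ α : V, ‖α‖ = 1 ∧ hyperplaneReflection α = (g : V ≃ₗᵢ[ℝ] V)}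
  let p : ι → Submodule ℝ V := fun g =>
    LinearMap.eqLocus ((g.1.1 : V ≃ₗᵢ[ℝ] V).toLinearEquiv : V →ₗ[ℝ] V) LinearMap.id
  have hp : ∀ g, p g ≠ ⊤ := by
    rintro ⟨g, α, hα, hg⟩ htop
    have h₁ : α ∈ p ⟨g, α, hα, hg⟩ := htop ▸ Submodule.mem_top
    have h₂ : (g : V ≃ₗᵢ[ℝ] V) α = α := h₁
    rw [← hg, hyperplaneReflection,
      Submodule.reflection_orthogonalComplement_singleton_eq_neg] at h₂
    have h₃ : α = 0 := by
      have h₄ : (2 : ℝ) • α = 0 := by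
        rw [two_smul]
        nth_rewrite 1 [← h₂]
        exact neg_add_cancel α
      simpa using h₄
    simp [h₃] at hα
  have hne : (⋃ g, (p g : Set V)) ≠ Set.univ := fun h => by
    obtain ⟨g, hg⟩ := Subspace.exists_eq_top_of_iUnion_eq_univ h
    exact hp g hg
  obtain ⟨x, hx⟩ := (Set.ne_univ_iff_exists_notMem _).1 hne
  refine ⟨⟨_, x, fun α hα h0 => hx (Set.mem_iUnion.2 ⟨⟨⟨_, hα.2⟩, α, hα.1, rfl⟩, ?_⟩), rfl⟩⟩
  exact (Submodule.reflection_eq_self_iff x).2 (Submodule.mem_orthogonal_singleton_iff_inner_right.2 h0)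

end

-- Fix a closed chamber C. Classical root combinatorics shows that C is cut out by its simple roots,
-- that these are linearly independent, and that simple reflections generate R. The exchange
-- property then gives `inner_map_le`: among the points of an R-orbit, the one in C is nearest to
-- every point of C. Hence C embeds isometrically in the orbit space.
--
-- An element outside the alternating subgroup has determinant -1, so V/R⁺ is covered by the images
-- of C and of one reflected copy of C. A segment from y in C to an orientation-reversing image of
-- y' in C meets the boundary of C at some z, and folding what lies beyond z back into C gives a
-- path from y through z to y'. Conversely, such a path unfolds by reflecting in a wall through z.
-- This identifies V/R⁺ with the double of C (`dist_doubleMap`).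
--
-- For the upper bound, the double is mapped to V × ℝ by y ↦ (y, ± distance from y to the boundary).
-- If d and t are the differences of the two coordinates and D is the distance in the double, then
-- d, |t| ≤ D ≤ d + |t|; so each bi-Lipschitz estimate costs at most a factor √2, and the distortion
-- is at most 2.
--
-- For the lower bound, two simple roots whose reflections have a product of order n ≥ 2 have walls
-- meeting at the angle φ = π/n (`angle_eq`). A unit circle around a point on both walls, far from
-- all others, becomes in V/R⁺ a closed curve of length 2φ whose opposite points have distance at
-- least 2 sin(φ/2). Inner product spaces resist this: a closed polygon with 2M vertices and
-- opposite vertices at distance at least D has an edge of length at least sin(π/(2M)) D. Inscribing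
-- polygons and letting M → ∞ yields n sin(π/(2n)). This quantity increases with n and equals √2 at
-- n = 2 and 3/2 at n = 3.

universe u

/-! ### Hyperplane reflections and unit roots -/

section Roots

variable {V : Type*} [NormedAddCommGroup V] [InnerProductSpace ℝ V]

theorem hyperplaneReflection_apply {α : V} (hα : ‖α‖ = 1) (v : V) :
    hyperplaneReflection α v = v - (2 * inner ℝ α v) • α := by
  rw [hyperplaneReflection, Submodule.reflection_orthogonal_apply,
    Submodule.reflection_singleton_apply, hα, two_mul, add_smul, two_smul]
  simp

theorem hyperplaneReflection_apply_eq_self {α v : V} (h : inner ℝ α v = 0) :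
    hyperplaneReflection α v = v :=
  (Submodule.reflection_eq_self_iff v).2 (Submodule.mem_orthogonal_singleton_iff_inner_right.2 h)

theorem hyperplaneReflection_mul_self (α : V) :
    hyperplaneReflection α * hyperplaneReflection α = 1 :=
  Submodule.reflection_mul_reflection _

theorem hyperplaneReflection_inv (α : V) :
    (hyperplaneReflection α)⁻¹ = hyperplaneReflection α :=
  Submodule.reflection_inv

theorem hyperplaneReflection_involutive (α v : V) :
    hyperplaneReflection α (hyperplaneReflection α v) = v :=
  Submodule.reflection_reflection _ v

theorem hyperplaneReflection_neg (α : V) :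
    hyperplaneReflection (-α) = hyperplaneReflection α := by
  ext v
  rw [hyperplaneReflection, hyperplaneReflection]
  simp only [Submodule.reflection_orthogonal_apply, Submodule.reflection_singleton_apply,
    norm_neg, inner_neg_left, neg_div, smul_neg, neg_smul, neg_neg]

theorem inner_hyperplaneReflection_left (α v w : V) :
    inner ℝ (hyperplaneReflection α v) w = inner ℝ v (hyperplaneReflection α w) := by
  conv_lhs => rw [← (hyperplaneReflection α).inner_map_map, hyperplaneReflection_involutive]

theorem hyperplaneReflection_map {α : V} (hα : ‖α‖ = 1) (g : V ≃ₗᵢ[ℝ] V) :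
    hyperplaneReflection (g α) = g * hyperplaneReflection α * g⁻¹ := by
  ext v
  have h : inner ℝ (g α) v = inner ℝ α (g⁻¹ v) := by
    conv_lhs => rw [← g.apply_symm_apply v, g.inner_map_map]
    rfl
  change _ = g (hyperplaneReflection α (g⁻¹ v))
  rw [hyperplaneReflection_apply (by rw [g.norm_map, hα]), hyperplaneReflection_apply hα,
    map_sub, map_smul, h]
  congr 1
  exact (g.apply_symm_apply v).symm

theorem eq_or_eq_neg_of_forall_inner_eq_zero {α β : V} (hα : ‖α‖ = 1) (hβ : ‖β‖ = 1)
    (h : ∀ v, inner ℝ α v = 0 → inner ℝ β v = 0) : β = α ∨ β = -α := by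
  have h₁ : inner ℝ β (β - (inner ℝ α β : ℝ) • α) = 0 := h _ (by
    rw [inner_sub_right, inner_smul_right, real_inner_self_eq_norm_sq, hα]; ring)
  rw [inner_sub_right, inner_smul_right, real_inner_self_eq_norm_sq, hβ, real_inner_comm] at h₁
  have h₂ : (inner ℝ β α : ℝ) = 1 ∨ (inner ℝ β α : ℝ) = -1 := by
    rw [← sq_eq_one_iff]; linarith [real_inner_comm α β, sq (inner ℝ β α : ℝ)]
  rcases h₂ with h₂ | h₂
  · exact Or.inl ((inner_eq_one_iff_of_norm_eq_one (𝕜 := ℝ) hβ hα).1 h₂)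
  · refine Or.inr ((inner_eq_one_iff_of_norm_eq_one (𝕜 := ℝ) hβ (by rwa [norm_neg])).1 ?_)
    rw [inner_neg_right, h₂, neg_neg]

theorem eq_or_eq_neg_of_hyperplaneReflection_eq {α β : V} (hα : ‖α‖ = 1) (hβ : ‖β‖ = 1)
    (h : hyperplaneReflection α = hyperplaneReflection β) : β = α ∨ β = -α := by
  refine eq_or_eq_neg_of_forall_inner_eq_zero hα hβ fun v hv => ?_
  have h₁ := hyperplaneReflection_apply_eq_self hv
  rw [h, hyperplaneReflection_apply hβ] at h₁
  have h₂ : (2 * inner ℝ β v : ℝ) • β = 0 := by simpa using h₁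
  rcases smul_eq_zero.1 h₂ with h₃ | h₃
  · linarith
  · simp [h₃] at hβ

variable {R : Subgroup (V ≃ₗᵢ[ℝ] V)}

theorem neg_mem_unitRoots {α : V} (hα : α ∈ unitRoots R) : -α ∈ unitRoots R :=
  ⟨by rw [norm_neg, hα.1], by rw [hyperplaneReflection_neg]; exact hα.2⟩

theorem map_mem_unitRoots {g : V ≃ₗᵢ[ℝ] V} (hg : g ∈ R) {α : V} (hα : α ∈ unitRoots R) :
    g α ∈ unitRoots R :=
  ⟨by rw [g.norm_map, hα.1], by
    rw [hyperplaneReflection_map hα.1]; exact R.mul_mem (R.mul_mem hg hα.2) (R.inv_mem hg)⟩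

end Roots

/-! ### Positive and simple roots, generation by simple reflections, the chamber as a fundamental
domain -/

namespace WeylChamber

variable {V : Type*} [NormedAddCommGroup V] [InnerProductSpace ℝ V]
  {R : Subgroup (V ≃ₗᵢ[ℝ] V)} (C : WeylChamber R)

/-- The roots that are nonnegative on the chamber. -/
def positiveRoots : Set V := {α | α ∈ unitRoots R ∧ ∀ v ∈ C.carrier, 0 ≤ inner ℝ α v}

/-- A point of the chamber that is on no reflecting hyperplane. -/
noncomputable def basePoint : V := C.exists_regular.choose

theorem inner_basePoint_ne_zero {α : V} (hα : α ∈ unitRoots R) : inner ℝ α C.basePoint ≠ 0 :=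
  C.exists_regular.choose_spec.1 α hα

theorem mem_carrier_iff {v : V} :
    v ∈ C.carrier ↔ ∀ α ∈ unitRoots R, 0 ≤ inner ℝ α C.basePoint * inner ℝ α v := by
  conv_lhs => rw [C.exists_regular.choose_spec.2]
  rfl

theorem basePoint_mem : C.basePoint ∈ C.carrier :=
  C.mem_carrier_iff.2 fun _ _ => mul_self_nonneg _

theorem zero_mem : (0 : V) ∈ C.carrier :=
  C.mem_carrier_iff.2 fun _ _ => by simp

variable {C}

theorem inner_basePoint_pos {α : V} (hα : α ∈ C.positiveRoots) : 0 < inner ℝ α C.basePoint :=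
  lt_of_le_of_ne (hα.2 _ C.basePoint_mem) (C.inner_basePoint_ne_zero hα.1).symm

theorem mem_positiveRoots_iff {α : V} :
    α ∈ C.positiveRoots ↔ α ∈ unitRoots R ∧ 0 < inner ℝ α C.basePoint :=
  ⟨fun h => ⟨h.1, inner_basePoint_pos h⟩, fun h => ⟨h.1, fun _ hv =>
    nonneg_of_mul_nonneg_right (C.mem_carrier_iff.1 hv α h.1) h.2⟩⟩

theorem mem_positiveRoots_or_neg_mem {α : V} (hα : α ∈ unitRoots R) :
    α ∈ C.positiveRoots ∨ -α ∈ C.positiveRoots := by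
  rcases (C.inner_basePoint_ne_zero hα).lt_or_gt with h | h
  · exact Or.inr (mem_positiveRoots_iff.2 ⟨neg_mem_unitRoots hα, by rw [inner_neg_left]; linarith⟩)
  · exact Or.inl (mem_positiveRoots_iff.2 ⟨hα, h⟩)

theorem neg_notMem_positiveRoots {α : V} (hα : α ∈ C.positiveRoots) : -α ∉ C.positiveRoots := by
  intro h
  have h₁ := inner_basePoint_pos hα
  have h₂ := inner_basePoint_pos h
  rw [inner_neg_left] at h₂
  linarith

theorem mem_carrier_iff_positiveRoots {v : V} :
    v ∈ C.carrier ↔ ∀ α ∈ C.positiveRoots, 0 ≤ inner ℝ α v := by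
  refine ⟨fun hv α hα => hα.2 v hv, fun h => C.mem_carrier_iff.2 fun α hα => ?_⟩
  rcases mem_positiveRoots_or_neg_mem (C := C) hα with h' | h'
  · exact mul_nonneg (inner_basePoint_pos h').le (h α h')
  · have h₁ := inner_basePoint_pos h'
    have h₂ := h _ h'
    rw [inner_neg_left] at h₁ h₂
    nlinarith

theorem simpleRoots_subset : C.simpleRoots ⊆ C.positiveRoots := fun _ h => ⟨h.1, h.2.1⟩

theorem eq_of_forall_inner_eq_zero {α β : V} (hα : α ∈ C.positiveRoots) (hβ : β ∈ C.positiveRoots)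
    (h : ∀ v, inner ℝ α v = 0 → inner ℝ β v = 0) : β = α := by
  rcases eq_or_eq_neg_of_forall_inner_eq_zero hα.1.1 hβ.1.1 h with h | h
  · exact h
  · exact absurd (h ▸ hβ) (neg_notMem_positiveRoots hα)

theorem finite_positiveRoots [Finite R] : C.positiveRoots.Finite := by
  refine Set.Finite.of_finite_image (f := hyperplaneReflection)
    ((Set.toFinite (R : Set (V ≃ₗᵢ[ℝ] V))).subset ?_) ?_
  · rintro _ ⟨α, hα, rfl⟩
    exact hα.1.2
  · intro α hα β hβ h
    rcases eq_or_eq_neg_of_hyperplaneReflection_eq hα.1.1 hβ.1.1 h with h | h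
    · exact h.symm
    · exact absurd (h ▸ hβ) (neg_notMem_positiveRoots hα)

theorem finite_simpleRoots [Finite R] : C.simpleRoots.Finite :=
  finite_positiveRoots.subset simpleRoots_subset

/-- A linear form that vanishes on a facet vanishes on its hyperplane. -/
theorem inner_eq_zero_of_facet {α γ : V} (hα : α ∈ C.simpleRoots)
    (h : ∀ v ∈ C.carrier, inner ℝ α v = 0 → inner ℝ γ v = 0) {v : V} (hv : inner ℝ α v = 0) :
    inner ℝ γ v = 0 := by
  have hv' : v ∈ Submodule.span ℝ (C.carrier ∩ ((ℝ ∙ α)ᗮ : Submodule ℝ V)) := by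
    rw [hα.2.2]; exact Submodule.mem_orthogonal_singleton_iff_inner_right.2 hv
  have h' : Submodule.span ℝ (C.carrier ∩ ((ℝ ∙ α)ᗮ : Submodule ℝ V)) ≤ (ℝ ∙ γ)ᗮ := by
    refine Submodule.span_le.2 fun w hw => Submodule.mem_orthogonal_singleton_iff_inner_right.2 ?_
    exact h w hw.1 (Submodule.mem_orthogonal_singleton_iff_inner_right.1 hw.2)
  exact Submodule.mem_orthogonal_singleton_iff_inner_right.1 (h' hv')

/-- A positive root that bounds the chamber irredundantly is simple. -/
theorem mem_simpleRoots_of_irredundant {D : Set V} (hDfin : D.Finite) (hD : D ⊆ C.positiveRoots)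
    (hDC : ∀ v, (∀ β ∈ D, 0 ≤ inner ℝ β v) → v ∈ C.carrier) {α : V} (hα : α ∈ D) {u : V}
    (hu : ∀ β ∈ D, β ≠ α → 0 ≤ inner ℝ β u) (huα : inner ℝ α u < 0) : α ∈ C.simpleRoots := by
  refine ⟨(hD hα).1, (hD hα).2, ?_⟩
  have hx : ∀ β ∈ D, 0 < inner ℝ β C.basePoint := fun β hβ => inner_basePoint_pos (hD hβ)
  set a : ℝ := inner ℝ α C.basePoint with ha
  set b : ℝ := inner ℝ α u with hb
  have ha0 : 0 < a := hx α hα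
  -- Up to scaling, the point where the segment from the base point to u crosses the hyperplane of
  -- α. Since b < 0 < a, it is strictly positive on every other root of D.
  set w : V := a • u - b • C.basePoint with hw
  have hwα : inner ℝ α w = 0 := by
    rw [hw, inner_sub_right, inner_smul_right, inner_smul_right, ← ha, ← hb]; ring
  have hwβ : ∀ β ∈ D, β ≠ α → 0 < inner ℝ β w := fun β hβ hne => by
    rw [hw, inner_sub_right, inner_smul_right, inner_smul_right]
    nlinarith [hu β hβ hne, hx β hβ, mul_nonneg ha0.le (hu β hβ hne)]
  refine le_antisymm (Submodule.span_le.2 fun v hv => hv.2) fun v hv => ?_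
  have hvα : inner ℝ α v = 0 := Submodule.mem_orthogonal_singleton_iff_inner_right.1 hv
  -- A large multiple of w pushes any v of the hyperplane into the facet, so v is a combination of
  -- the facet points v + N • w and w.
  obtain ⟨N, hN⟩ : ∃ N : ℝ, ∀ β ∈ D, β ≠ α → 0 ≤ inner ℝ β (v + N • w) := by
    obtain ⟨N, hN⟩ := (hDfin.image fun β => -(inner ℝ β v / inner ℝ β w : ℝ)).bddAbove
    refine ⟨N, fun β hβ hne => ?_⟩
    have h₁ := hN (Set.mem_image_of_mem _ hβ)
    have h₂ := hwβ β hβ hne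
    rw [inner_add_right, inner_smul_right]
    have h₃ : -N * inner ℝ β w ≤ inner ℝ β v := by
      rw [← le_div_iff₀ h₂]; linarith
    linarith
  have hmem : ∀ p : V, inner ℝ α p = 0 → (∀ β ∈ D, β ≠ α → 0 ≤ inner ℝ β p) →
      p ∈ Submodule.span ℝ (C.carrier ∩ ((ℝ ∙ α)ᗮ : Submodule ℝ V)) := fun p hp h => by
    refine Submodule.subset_span ⟨hDC p fun β hβ => ?_,
      Submodule.mem_orthogonal_singleton_iff_inner_right.2 hp⟩
    by_cases hne : β = α
    · rw [hne, hp]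
    · exact h β hβ hne
  have h₁ := hmem (v + N • w) (by rw [inner_add_right, inner_smul_right, hvα, hwα]; simp) hN
  have h₂ := hmem w hwα fun β hβ hne => (hwβ β hβ hne).le
  simpa using Submodule.sub_mem _ h₁ (Submodule.smul_mem _ N h₂)

/-- The chamber is cut out by its simple roots. -/
theorem mem_carrier_iff_simpleRoots [Finite R] {v : V} :
    v ∈ C.carrier ↔ ∀ α ∈ C.simpleRoots, 0 ≤ inner ℝ α v := by
  refine ⟨fun hv α hα => hα.2.1 v hv, fun hv => ?_⟩
  -- A minimal set of positive roots that cuts out the chamber has only irredundant members, and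
  -- these are simple.
  let P : Set V → Prop := fun D =>
    D ⊆ C.positiveRoots ∧ ∀ v, (∀ β ∈ D, 0 ≤ inner ℝ β v) → v ∈ C.carrier
  have hP : P C.positiveRoots := ⟨subset_rfl, fun v h => mem_carrier_iff_positiveRoots.2 h⟩
  have hfin : {D | P D}.Finite :=
    (finite_positiveRoots (C := C)).finite_subsets.subset fun D hD => hD.1
  obtain ⟨D, hDmin⟩ := hfin.exists_minimal ⟨_, hP⟩
  have hD : P D := hDmin.prop
  refine hD.2 v fun α hα => hv α ?_
  have hnot : ¬ P (D \ {α}) := fun h =>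
    ((hDmin.le_of_le h Set.sdiff_subset) hα).2 rfl
  have : ∃ u, (∀ β ∈ D \ {α}, 0 ≤ inner ℝ β u) ∧ u ∉ C.carrier := by
    by_contra! hcon
    exact hnot ⟨Set.sdiff_subset.trans hD.1, hcon⟩
  obtain ⟨u, hu, huC⟩ := this
  refine mem_simpleRoots_of_irredundant (finite_positiveRoots.subset hD.1) hD.1 hD.2 hα
    (u := u) (fun β hβ hne => hu β ⟨hβ, hne⟩) ?_
  by_contra! h
  refine huC (hD.2 u fun β hβ => ?_)
  by_cases hne : β = α
  · rwa [hne]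
  · exact hu β ⟨hβ, hne⟩

/-- A simple reflection permutes the positive roots other than its own. -/
theorem hyperplaneReflection_mem_positiveRoots {α β : V} (hα : α ∈ C.simpleRoots)
    (hβ : β ∈ C.positiveRoots) (hne : β ≠ α) : hyperplaneReflection α β ∈ C.positiveRoots := by
  -- If the reflected root were negative, then β, which agrees with it on the facet of α, would be
  -- both nonpositive and nonnegative there. So it would vanish on the facet and equal α.
  refine (mem_positiveRoots_or_neg_mem (map_mem_unitRoots hα.1.2 hβ.1)).resolve_right fun h => ?_
  refine hne (eq_of_forall_inner_eq_zero (simpleRoots_subset hα) hβ fun v hv => ?_)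
  refine inner_eq_zero_of_facet hα (fun w hw hαw => ?_) hv
  have h₁ := h.2 w hw
  rw [inner_neg_left, inner_hyperplaneReflection_left, hyperplaneReflection_apply_eq_self hαw] at h₁
  exact le_antisymm (by linarith) (hβ.2 w hw)

/-- If the product were positive, evaluating the positive root β - 2⟪α, β⟫α on the facet of β would
force α to vanish there, whence α = β. -/
theorem inner_nonpos_of_simpleRoots {α β : V} (hα : α ∈ C.simpleRoots) (hβ : β ∈ C.simpleRoots)
    (hne : α ≠ β) : inner ℝ α β ≤ 0 := by
  by_contra! hpos
  have hγ := hyperplaneReflection_mem_positiveRoots hα (simpleRoots_subset hβ) hne.symm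
  refine hne (eq_of_forall_inner_eq_zero (simpleRoots_subset hβ) (simpleRoots_subset hα)
    fun v hv => inner_eq_zero_of_facet hβ (fun w hw hβw => ?_) hv)
  have h₁ := hγ.2 w hw
  have h₂ := hα.2.1 w hw
  rw [hyperplaneReflection_apply hα.1.1, inner_sub_left, inner_smul_left, hβw] at h₁
  simp only [conj_trivial] at h₁
  nlinarith

/-- Vectors at pairwise nonacute angles on one open side of a hyperplane are independent; the base
point supplies that hyperplane. -/
theorem linearIndependent_simpleRoots :
    LinearIndependent ℝ (Subtype.val : C.simpleRoots → V) := by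
  refine LinearMap.BilinForm.linearIndependent_of_pairwise_le_zero (innerₗ V) ?_
    (innerₗ V C.basePoint) _ ?_ ?_
  · intro v hv
    simpa [LinearMap.BilinMap.toQuadraticMap_apply] using real_inner_self_pos.2 hv
  · intro α
    rw [innerₗ_apply_apply, real_inner_comm]
    exact inner_basePoint_pos (simpleRoots_subset α.2)
  · intro α β hne
    rw [innerₗ_apply_apply]
    exact inner_nonpos_of_simpleRoots α.2 β.2 (Subtype.coe_ne_coe.2 hne)

/-- Every reflection of `R` is a product of simple reflections. -/
theorem hyperplaneReflection_mem_closure [Finite R] {β : V} (hβ : β ∈ C.positiveRoots) :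
    hyperplaneReflection β ∈ Subgroup.closure (hyperplaneReflection '' C.simpleRoots) := by
  set W := Subgroup.closure (hyperplaneReflection '' C.simpleRoots) with hW
  -- Among the positive roots in the W-orbit of β, take γ of least height over the base point. Some
  -- simple α has a positive product with γ, since otherwise -γ would lie in the chamber. Unless γ =
  -- α, reflecting in α would lower the height.
  let S : Set V := {γ | γ ∈ C.positiveRoots ∧ ∃ w ∈ W, w β = γ}
  obtain ⟨γ, ⟨hγ, w, hw, hwβ⟩, hmin⟩ := Set.exists_min_image S
    (fun γ => (inner ℝ γ C.basePoint : ℝ)) (finite_positiveRoots.subset fun _ h => h.1)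
    ⟨β, hβ, 1, W.one_mem, rfl⟩
  obtain ⟨α, hα, hαγ⟩ : ∃ α ∈ C.simpleRoots, 0 < inner ℝ α γ := by
    by_contra! hcon
    have h₁ := hγ.2 (-γ) (mem_carrier_iff_simpleRoots.2 fun α hα => by
      rw [inner_neg_right]; linarith [hcon α hα])
    rw [inner_neg_right, real_inner_self_eq_norm_sq, hγ.1.1] at h₁
    norm_num at h₁
  have hsα : hyperplaneReflection α ∈ W := Subgroup.subset_closure (Set.mem_image_of_mem _ hα)
  by_cases hne : γ = α
  · have h₁ : hyperplaneReflection β = w⁻¹ * hyperplaneReflection γ * w := by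
      rw [← hwβ, hyperplaneReflection_map hβ.1.1]; group
    rw [h₁, hne]
    exact W.mul_mem (W.mul_mem (W.inv_mem hw) hsα) hw
  · exfalso
    have h₁ := hmin (hyperplaneReflection α γ) ⟨hyperplaneReflection_mem_positiveRoots hα hγ hne,
      hyperplaneReflection α * w, W.mul_mem hsα hw,
        congrArg (hyperplaneReflection α) hwβ⟩
    rw [hyperplaneReflection_apply hα.1.1, inner_sub_left, inner_smul_left] at h₁
    simp only [conj_trivial] at h₁
    nlinarith [mul_pos hαγ (inner_basePoint_pos (simpleRoots_subset hα))]

/-- A reflection group is generated by its simple reflections. -/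
theorem closure_simpleRoots [Finite R] (hR : IsReflectionGroup R) :
    Subgroup.closure (hyperplaneReflection '' C.simpleRoots) = R := by
  refine le_antisymm ((Subgroup.closure_le _).2 ?_) ?_
  · rintro _ ⟨α, hα, rfl⟩
    exact hα.1.2
  · refine hR.symm.le.trans ((Subgroup.closure_le _).2 ?_)
    rintro _ ⟨α, hα, rfl⟩
    rcases mem_positiveRoots_or_neg_mem (C := C) hα with h | h
    · exact hyperplaneReflection_mem_closure h
    · rw [← hyperplaneReflection_neg]
      exact hyperplaneReflection_mem_closure h

theorem exists_list_prod_eq [Finite R] (hR : IsReflectionGroup R) {g : V ≃ₗᵢ[ℝ] V} (hg : g ∈ R) :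
    ∃ L : List V, (∀ α ∈ L, α ∈ C.simpleRoots) ∧ (L.map hyperplaneReflection).prod = g := by
  rw [← closure_simpleRoots (C := C) hR] at hg
  induction hg using Subgroup.closure_induction with
  | mem x hx =>
    obtain ⟨α, hα, rfl⟩ := hx
    exact ⟨[α], by simpa using hα, by simp⟩
  | one => exact ⟨[], by simp, by simp⟩
  | mul x y _ _ hx hy =>
    obtain ⟨L, hL, rfl⟩ := hx
    obtain ⟨L', hL', rfl⟩ := hy
    refine ⟨L ++ L', fun α hα => ?_, by simp⟩
    rcases List.mem_append.1 hα with h | h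
    · exact hL α h
    · exact hL' α h
  | inv x _ hx =>
    obtain ⟨L, hL, rfl⟩ := hx
    refine ⟨L.reverse, fun α hα => hL α (List.mem_reverse.1 hα), ?_⟩
    rw [List.prod_inv_reverse, List.map_map, List.map_reverse]
    refine congrArg (fun l => (List.reverse l).prod) ?_
    exact List.map_congr_left fun α _ => (hyperplaneReflection_inv α).symm

theorem list_prod_mem {L : List V} (hL : ∀ α ∈ L, α ∈ C.simpleRoots) :
    (L.map hyperplaneReflection).prod ∈ R := by
  refine R.list_prod_mem fun g hg => ?_
  obtain ⟨α, hα, rfl⟩ := List.mem_map.1 hg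
  exact (hL α hα).1.2

/-- The exchange property. -/
theorem exists_list_of_notMem_positiveRoots {α : V} (hα : α ∈ C.simpleRoots) (L : List V)
    (hL : ∀ β ∈ L, β ∈ C.simpleRoots)
    (hneg : (L.map hyperplaneReflection).prod α ∉ C.positiveRoots) :
    ∃ L' : List V, (∀ β ∈ L', β ∈ C.simpleRoots) ∧ L'.length + 1 = L.length ∧
      (L'.map hyperplaneReflection).prod =
        (L.map hyperplaneReflection).prod * hyperplaneReflection α := by
  induction L with
  | nil => exact absurd (simpleRoots_subset hα) hneg
  | cons β L ih =>
    have hβ : β ∈ C.simpleRoots := hL β (by simp)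
    have hL₀ : ∀ γ ∈ L, γ ∈ C.simpleRoots := fun γ hγ => hL γ (by simp [hγ])
    by_cases h : (L.map hyperplaneReflection).prod α ∈ C.positiveRoots
    · refine ⟨L, hL₀, by simp, ?_⟩
      -- The letter β turns the positive root obtained so far into a negative one, and the only such
      -- root is β itself. Conjugation then turns the reflection in α into that in β, which cancels
      -- this letter.
      have h₁ : (L.map hyperplaneReflection).prod α = β := by
        by_contra hne
        refine hneg ?_
        rw [List.map_cons, List.prod_cons]
        exact hyperplaneReflection_mem_positiveRoots hβ h hne
      have h₂ := hyperplaneReflection_map hα.1.1 (L.map hyperplaneReflection).prod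
      rw [h₁] at h₂
      rw [List.map_cons, List.prod_cons, h₂]
      simp only [mul_assoc, inv_mul_cancel_left, hyperplaneReflection_mul_self, mul_one]
    · obtain ⟨L', hL', hlen, hprod⟩ := ih hL₀ h
      refine ⟨β :: L', ?_, by simp [hlen], ?_⟩
      · intro γ hγ
        rcases List.mem_cons.1 hγ with rfl | hγ
        · exact hβ
        · exact hL' γ hγ
      · simp only [List.map_cons, List.prod_cons, hprod, mul_assoc]

/-- Strong induction on word length. Let α be the last letter and g the product of the others. If g
α is positive, appending α subtracts a nonnegative term from the product with y; if not, the
exchange property gives a shorter word for the same element. -/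
theorem inner_list_prod_le {y y' : V} (hy : y ∈ C.carrier) (hy' : y' ∈ C.carrier) (k : ℕ) :
    ∀ L : List V, L.length = k → (∀ β ∈ L, β ∈ C.simpleRoots) →
      inner ℝ y ((L.map hyperplaneReflection).prod y') ≤ inner ℝ y y' := by
  induction k using Nat.strong_induction_on with
  | _ k ih =>
    intro L hlen hL
    rcases List.eq_nil_or_concat' L with rfl | ⟨L₀, α, rfl⟩
    · simp
    · have hα : α ∈ C.simpleRoots := hL α (by simp)
      have hL₀ : ∀ γ ∈ L₀, γ ∈ C.simpleRoots := fun γ hγ => hL γ (by simp [hγ])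
      have hlen₀ : L₀.length < k := by rw [← hlen]; simp
      set g := (L₀.map hyperplaneReflection).prod with hg
      have hprod : ((L₀ ++ [α]).map hyperplaneReflection).prod = g * hyperplaneReflection α := by
        simp [hg]
      by_cases h : g α ∈ C.positiveRoots
      · have h₁ : (g * hyperplaneReflection α) y' = g y' - (2 * inner ℝ α y') • g α := by
          change g (hyperplaneReflection α y') = _
          rw [hyperplaneReflection_apply hα.1.1, map_sub, map_smul]
        rw [hprod, h₁, inner_sub_right, inner_smul_right]
        have h₂ := ih _ hlen₀ L₀ rfl hL₀
        have h₃ := h.2 y hy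
        rw [real_inner_comm] at h₃
        nlinarith [mul_nonneg (hα.2.1 y' hy') h₃]
      · obtain ⟨L', hL', hlen', hprod'⟩ := exists_list_of_notMem_positiveRoots hα L₀ hL₀ h
        rw [hprod, ← hprod']
        exact ih _ (by omega) L' rfl hL'

/-- Among the points of an orbit, the one in the chamber is closest to any point of the chamber. -/
theorem inner_map_le [Finite R] (hR : IsReflectionGroup R) {y y' : V} (hy : y ∈ C.carrier)
    (hy' : y' ∈ C.carrier) {g : V ≃ₗᵢ[ℝ] V} (hg : g ∈ R) : inner ℝ y (g y') ≤ inner ℝ y y' := by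
  obtain ⟨L, hL, rfl⟩ := exists_list_prod_eq (C := C) hR hg
  exact inner_list_prod_le hy hy' _ L rfl hL

theorem dist_le_dist_map [Finite R] (hR : IsReflectionGroup R) {y y' : V} (hy : y ∈ C.carrier)
    (hy' : y' ∈ C.carrier) {g : V ≃ₗᵢ[ℝ] V} (hg : g ∈ R) : dist y y' ≤ dist y (g y') := by
  rw [dist_eq_norm, dist_eq_norm]
  refine (sq_le_sq₀ (norm_nonneg _) (norm_nonneg _)).1 ?_
  rw [norm_sub_sq_real, norm_sub_sq_real, g.norm_map]
  linarith [inner_map_le hR hy hy' hg]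

theorem map_eq_self_of_map_mem [Finite R] (hR : IsReflectionGroup R) {y : V} (hy : y ∈ C.carrier)
    {g : V ≃ₗᵢ[ℝ] V} (hg : g ∈ R) (hgy : g y ∈ C.carrier) : g y = y := by
  have h := dist_le_dist_map hR hgy hy hg
  rw [dist_self] at h
  exact dist_le_zero.1 h

variable (C) in
theorem exists_map_mem [Finite R] (v : V) : ∃ g ∈ R, g v ∈ C.carrier := by
  -- The orbit point with the largest product with the base point lies in the chamber: a positive
  -- root negative on it would give a reflection increasing that product.
  obtain ⟨g, hg, hmax⟩ := Set.exists_max_image (R : Set (V ≃ₗᵢ[ℝ] V))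
    (fun g => (inner ℝ (g v) C.basePoint : ℝ)) (Set.toFinite _) ⟨1, R.one_mem⟩
  refine ⟨g, hg, mem_carrier_iff_positiveRoots.2 fun α hα => ?_⟩
  have h : inner ℝ (hyperplaneReflection α (g v)) C.basePoint ≤ inner ℝ (g v) C.basePoint :=
    hmax (hyperplaneReflection α * g) (R.mul_mem hα.1.2 hg)
  rw [hyperplaneReflection_apply hα.1.1, inner_sub_left, inner_smul_left] at h
  simp only [conj_trivial] at h
  exact nonneg_of_mul_nonneg_left (by linarith) (inner_basePoint_pos hα)

/-! ### Boundary and interior of the chamber -/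

theorem isClosed_carrier : IsClosed C.carrier := by
  have : C.carrier = ⋂ α ∈ C.positiveRoots, {v | 0 ≤ inner ℝ α v} := by
    ext v; simpa using mem_carrier_iff_positiveRoots
  rw [this]
  exact isClosed_biInter fun α _ => isClosed_le continuous_const (by fun_prop)

theorem mem_frontier_of_inner_eq_zero {α : V} (hα : α ∈ C.positiveRoots) {v : V}
    (hv : v ∈ C.carrier) (h : inner ℝ α v = 0) : v ∈ frontier C.carrier := by
  rw [isClosed_carrier.frontier_eq]
  refine ⟨hv, fun hint => ?_⟩
  have hlim : Filter.Tendsto (fun t : ℝ => v - t • α) (nhdsWithin 0 (Set.Ioi 0)) (nhds v) := by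
    have : Continuous fun t : ℝ => v - t • α := by fun_prop
    simpa using (this.tendsto 0).mono_left nhdsWithin_le_nhds
  obtain ⟨t, ht, ht0⟩ :=
    ((hlim.eventually (mem_interior_iff_mem_nhds.1 hint)).and self_mem_nhdsWithin).exists
  have h₁ := hα.2 _ ht
  rw [inner_sub_right, inner_smul_right, h, real_inner_self_eq_norm_sq, hα.1.1] at h₁
  have : (0 : ℝ) < t := ht0
  linarith

theorem exists_inner_eq_zero_of_mem_frontier [Finite R] {v : V} (hv : v ∈ frontier C.carrier) :
    ∃ α ∈ C.simpleRoots, inner ℝ α v = 0 := by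
  by_contra! h
  have hvC : v ∈ C.carrier := isClosed_carrier.frontier_subset hv
  have hopen : IsOpen (⋂ α ∈ C.simpleRoots, {w : V | 0 < inner ℝ α w}) :=
    finite_simpleRoots.isOpen_biInter fun α _ => isOpen_lt continuous_const (by fun_prop)
  have hsub : (⋂ α ∈ C.simpleRoots, {w : V | 0 < inner ℝ α w}) ⊆ C.carrier := fun w hw =>
    mem_carrier_iff_simpleRoots.2 fun α hα =>
      (show 0 < inner ℝ α w from Set.mem_iInter₂.1 hw α hα).le
  refine hv.2 (interior_maximal hsub hopen (Set.mem_iInter₂.2 fun α hα => ?_))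
  exact lt_of_le_of_ne (hα.2.1 v hvC) (h α hα).symm

/-- The stabilizers of the interior points of the chamber are trivial. -/
theorem eq_one_of_map_eq_self [Finite R] (hR : IsReflectionGroup R) {y : V}
    (hy : y ∈ interior C.carrier) {g : V ≃ₗᵢ[ℝ] V} (hg : g ∈ R) (hgy : g y = y) : g = 1 := by
  -- Points near y stay in the chamber under g, so g fixes them; by linearity it fixes every
  -- direction v.
  have h₁ : ∀ᶠ v in nhds y, v ∈ C.carrier := mem_interior_iff_mem_nhds.1 hy
  have h₂ : ∀ᶠ v in nhds y, g v ∈ C.carrier := by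
    have := g.continuous.tendsto y
    rw [hgy] at this
    exact this.eventually h₁
  ext v
  change g v = v
  have hlim : Filter.Tendsto (fun t : ℝ => y + t • v) (nhdsWithin 0 (Set.Ioi 0)) (nhds y) := by
    have : Continuous fun t : ℝ => y + t • v := by fun_prop
    simpa using (this.tendsto 0).mono_left nhdsWithin_le_nhds
  obtain ⟨t, ⟨ht₁, ht₂⟩, ht⟩ :=
    ((hlim.eventually (h₁.and h₂)).and self_mem_nhdsWithin).exists
  have h := map_eq_self_of_map_mem hR ht₁ hg ht₂
  rw [map_add, hgy, map_smul] at h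
  exact smul_right_injective V (ne_of_gt ht) (add_left_cancel h)

theorem nonempty_simpleRoots [Finite R] (hR : IsReflectionGroup R) (hne : R ≠ ⊥) :
    C.simpleRoots.Nonempty := by
  by_contra! h
  refine hne ?_
  rw [← closure_simpleRoots (C := C) hR, h, Set.image_empty, Subgroup.closure_empty]

end WeylChamber

/-- Otherwise the interior of t and its complement would separate s. -/
theorem IsPreconnected.exists_mem_frontier {X : Type*} [TopologicalSpace X] {s t : Set X}
    (hs : IsPreconnected s) (ht : IsClosed t) (h₁ : (s ∩ t).Nonempty) (h₂ : (s ∩ tᶜ).Nonempty) :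
    ∃ z ∈ s, z ∈ frontier t := by
  by_contra! hcon
  have hint : ∀ z ∈ s, z ∈ t → z ∈ interior t := fun z hz hzt => by
    by_contra hzi
    exact hcon z hz (by rw [ht.frontier_eq]; exact ⟨hzt, hzi⟩)
  obtain ⟨y, hys, hyt⟩ := h₁
  obtain ⟨z, -, hz₁, hz₂⟩ := hs (interior t) tᶜ isOpen_interior ht.isOpen_compl
    (fun z hz => (em (z ∈ t)).imp (hint z hz) id) ⟨y, hys, hint y hys hyt⟩ h₂
  exact hz₂ (interior_subset hz₁)

/-! ### Distances between orbits -/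

namespace OrbitSpace

variable {G X : Type*} [Group G] [MulAction G X]

theorem mk_smul (g : G) (x : X) : mk G (g • x) = mk G x :=
  Quotient.sound (MulAction.orbitRel_apply.2 (MulAction.mem_orbit x g))

theorem mem_orbit_mk (x : X) : x ∈ (mk G x).orbit := by
  rw [orbit_mk]; exact MulAction.mem_orbit_self x

variable [PseudoMetricSpace X]

theorem dist_mk_le (x y : X) : dist (mk G x) (mk G y) ≤ dist x y :=
  dist_le (mem_orbit_mk x) (mem_orbit_mk y)

theorem le_dist_mk [IsIsometricSMul G X] {x y : X} {c : ℝ} (h : ∀ g : G, c ≤ dist x (g • y)) :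
    c ≤ dist (mk G x) (mk G y) := by
  have : Nonempty ((mk G x).orbit × (mk G y).orbit) := ⟨⟨x, mem_orbit_mk x⟩, ⟨y, mem_orbit_mk y⟩⟩
  refine le_ciInf fun ⟨⟨p, hp⟩, ⟨q, hq⟩⟩ => ?_
  rw [orbit_mk] at hp hq
  obtain ⟨g, rfl⟩ := hp
  obtain ⟨k, rfl⟩ := hq
  refine (h (g⁻¹ * k)).trans_eq ?_
  change _ = dist (g • x) (k • y)
  rw [← dist_smul g⁻¹ (g • x), inv_smul_smul, mul_smul]

end OrbitSpace

/-! ### Determinants and the alternating subgroup -/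

section Determinant

variable {V : Type*} [NormedAddCommGroup V] [InnerProductSpace ℝ V]

theorem det_mul_apply (g h : V ≃ₗᵢ[ℝ] V) :
    LinearMap.det ((g * h).toLinearEquiv : V →ₗ[ℝ] V) =
      LinearMap.det (g.toLinearEquiv : V →ₗ[ℝ] V) * LinearMap.det (h.toLinearEquiv : V →ₗ[ℝ] V) :=
  LinearMap.det_comp _ _

variable [FiniteDimensional ℝ V]

theorem det_hyperplaneReflection {α : V} (hα : α ≠ 0) :
    LinearMap.det ((hyperplaneReflection α).toLinearEquiv : V →ₗ[ℝ] V) = -1 := by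
  have h := (ℝ ∙ α)ᗮ.det_reflection
  rw [Submodule.orthogonal_orthogonal, finrank_span_singleton hα, pow_one] at h
  exact h

theorem det_eq_one_or_neg_one (g : V ≃ₗᵢ[ℝ] V) :
    LinearMap.det (g.toLinearEquiv : V →ₗ[ℝ] V) = 1 ∨
      LinearMap.det (g.toLinearEquiv : V →ₗ[ℝ] V) = -1 := by
  have h := g.toLinearIsometry.normDet_eq_one
  rw [LinearMap.normDet_eq_abs_det] at h
  exact eq_or_eq_neg_of_abs_eq h

variable {R : Subgroup (V ≃ₗᵢ[ℝ] V)}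

theorem hyperplaneReflection_notMem_alternatingSubgroup {α : V} (hα : α ≠ 0) :
    hyperplaneReflection α ∉ alternatingSubgroup R := by
  intro h
  have h₁ : LinearMap.det ((hyperplaneReflection α).toLinearEquiv : V →ₗ[ℝ] V) = 1 := h.2
  rw [det_hyperplaneReflection hα] at h₁
  norm_num at h₁

theorem hyperplaneReflection_mul_mem_alternatingSubgroup {α : V} (hα : α ∈ unitRoots R)
    {g : V ≃ₗᵢ[ℝ] V} (hg : g ∈ R) (hg' : g ∉ alternatingSubgroup R) :
    hyperplaneReflection α * g ∈ alternatingSubgroup R := by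
  have hα0 : α ≠ 0 := fun h => by simpa [h] using hα.1
  refine ⟨R.mul_mem hα.2 hg, ?_⟩
  change LinearMap.det _ = (1 : ℝ)
  rw [det_mul_apply, det_hyperplaneReflection hα0,
    (det_eq_one_or_neg_one g).resolve_left fun h => hg' ⟨hg, h⟩]
  norm_num

theorem mul_hyperplaneReflection_notMem_alternatingSubgroup {α : V} (hα : α ≠ 0)
    {g : V ≃ₗᵢ[ℝ] V} (hg : g ∈ alternatingSubgroup R) :
    g * hyperplaneReflection α ∉ alternatingSubgroup R := fun h =>
  hyperplaneReflection_notMem_alternatingSubgroup hα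
    (((alternatingSubgroup R).mul_mem_cancel_left hg).1 h)

end Determinant

/-! ### Folding segments into the chamber -/

namespace WeylChamber

variable {V : Type*} [NormedAddCommGroup V] [InnerProductSpace ℝ V]
  {R : Subgroup (V ≃ₗᵢ[ℝ] V)} [Finite R] {C : WeylChamber R}

/-- A segment from a point of the chamber to an orientation-reversing image of another one can be
folded to a path in the chamber that touches the boundary. -/
theorem exists_frontier_dist_add_dist_le [FiniteDimensional ℝ V] (hR : IsReflectionGroup R) {y y' : V}
    (hy : y ∈ C.carrier) (hy' : y' ∈ C.carrier) {g : V ≃ₗᵢ[ℝ] V} (hg : g ∈ R)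
    (hg' : g ∉ alternatingSubgroup R) :
    ∃ z ∈ frontier C.carrier, dist y z + dist y' z ≤ dist y (g y') := by
  -- In this case g fixes y'. As g ≠ 1, the point y' is not interior, and z = y' works.
  by_cases hgy : g y' ∈ C.carrier
  · have h := map_eq_self_of_map_mem hR hy' hg hgy
    rw [h]
    refine ⟨y', ?_, by simp⟩
    rw [isClosed_carrier.frontier_eq]
    refine ⟨hy', fun hint => hg' ?_⟩
    rw [eq_one_of_map_eq_self hR hint hg h]
    exact Subgroup.one_mem _
  -- The segment leaves the chamber at z; replacing its remainder by the segment from z to y' does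
  -- not lengthen it, by the nearest-point property.
  · obtain ⟨z, hz, hzf⟩ := (convex_segment y (g y')).isPreconnected.exists_mem_frontier
      isClosed_carrier ⟨y, left_mem_segment ℝ _ _, hy⟩ ⟨g y', right_mem_segment ℝ _ _, hgy⟩
    refine ⟨z, hzf, ?_⟩
    rw [← dist_add_dist_of_mem_segment hz, dist_comm y' z]
    gcongr
    exact dist_le_dist_map hR (isClosed_carrier.frontier_subset hzf) hy' hg

omit [Finite R] in
theorem nonempty_boundary {α : V} (hα : α ∈ C.simpleRoots) : Nonempty C.boundary :=
  ⟨⟨⟨0, C.zero_mem⟩, mem_frontier_of_inner_eq_zero (simpleRoots_subset hα) C.zero_mem (by simp)⟩⟩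

theorem dist_mk_mk (hR : IsReflectionGroup R) {y y' : V} (hy : y ∈ C.carrier)
    (hy' : y' ∈ C.carrier) :
    dist (OrbitSpace.mk (alternatingSubgroup R) y) (OrbitSpace.mk (alternatingSubgroup R) y') =
      dist y y' :=
  le_antisymm (OrbitSpace.dist_mk_le _ _)
    (OrbitSpace.le_dist_mk fun g => dist_le_dist_map hR hy hy' g.2.1)

theorem dist_mk_reflection_mk_reflection (hR : IsReflectionGroup R) {α : V}
    (hα : α ∈ C.simpleRoots) {y y' : V} (hy : y ∈ C.carrier) (hy' : y' ∈ C.carrier) :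
    dist (OrbitSpace.mk (alternatingSubgroup R) (hyperplaneReflection α y))
      (OrbitSpace.mk (alternatingSubgroup R) (hyperplaneReflection α y')) = dist y y' := by
  refine le_antisymm ((OrbitSpace.dist_mk_le _ _).trans_eq ((hyperplaneReflection α).dist_map _ _))
    (OrbitSpace.le_dist_mk fun g => ?_)
  refine (dist_le_dist_map hR hy hy' (R.mul_mem (R.mul_mem hα.1.2 g.2.1) hα.1.2)).trans_eq ?_
  rw [← (hyperplaneReflection α).dist_map]
  exact congrArg _ (hyperplaneReflection_involutive _ _)

/-- Upper bound: if z lies on the wall of β, then y' reflected in α and in β have the same R⁺-orbit,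
and the reflection in β fixes z, so the two legs join up. The lower bound is the folding of
segments. -/
theorem dist_mk_mk_reflection [FiniteDimensional ℝ V] (hR : IsReflectionGroup R) {α : V} (hα : α ∈ C.simpleRoots)
    {y y' : V} (hy : y ∈ C.carrier) (hy' : y' ∈ C.carrier) :
    dist (OrbitSpace.mk (alternatingSubgroup R) y)
      (OrbitSpace.mk (alternatingSubgroup R) (hyperplaneReflection α y')) =
      ⨅ z : C.boundary, (dist y z + dist y' z : ℝ) := by
  have hα0 : α ≠ 0 := fun h => by simpa [h] using hα.1.1
  have := nonempty_boundary hα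
  refine le_antisymm (le_ciInf fun ⟨⟨z, hzC⟩, hz⟩ => ?_) (OrbitSpace.le_dist_mk fun g => ?_)
  · obtain ⟨β, hβ, hβz⟩ := exists_inner_eq_zero_of_mem_frontier hz
    have hmem := hyperplaneReflection_mul_mem_alternatingSubgroup hβ.1 hα.1.2
      (hyperplaneReflection_notMem_alternatingSubgroup hα0)
    have h₁ : OrbitSpace.mk (alternatingSubgroup R) (hyperplaneReflection α y') =
        OrbitSpace.mk (alternatingSubgroup R) (hyperplaneReflection β y') := by
      rw [← OrbitSpace.mk_smul (⟨_, hmem⟩ : alternatingSubgroup R) (hyperplaneReflection α y')]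
      exact congrArg (OrbitSpace.mk _) (congrArg (hyperplaneReflection β)
        (hyperplaneReflection_involutive α y'))
    rw [h₁]
    refine (OrbitSpace.dist_mk_le _ _).trans ((dist_triangle _ z _).trans_eq ?_)
    rw [dist_comm y' z, ← (hyperplaneReflection β).dist_map z y',
      hyperplaneReflection_apply_eq_self hβz]
  · obtain ⟨z, hz, hle⟩ := exists_frontier_dist_add_dist_le hR hy hy' (R.mul_mem g.2.1 hα.1.2)
      (mul_hyperplaneReflection_notMem_alternatingSubgroup hα0 g.2)
    exact (ciInf_le (f := fun z : C.boundary => (dist y z + dist y' z : ℝ))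
      ⟨0, by rintro _ ⟨z, rfl⟩; positivity⟩ ⟨⟨z, isClosed_carrier.frontier_subset hz⟩, hz⟩).trans hle

end WeylChamber

/-! ### Real-number bounds for the distortion -/

section Distortion

variable {X Y : Type*} [PseudoMetricSpace X] [PseudoMetricSpace Y]

theorem distortion_le_of_dist_le {f : X → Y} {a b : ℝ} (ha : 0 < a)
    (hf : ∀ x y, a * dist x y ≤ dist (f x) (f y)) (hf' : ∀ x y, dist (f x) (f y) ≤ b * dist x y) :
    distortion f ≤ ENNReal.ofReal (b / a) := by
  have h₁ : ENNReal.ofReal a ≤ lowerLipschitzBound f := le_sSup fun x y => by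
    rw [edist_dist, edist_dist, ← ENNReal.ofReal_mul ha.le]
    exact ENNReal.ofReal_le_ofReal (hf x y)
  have h₂ : upperLipschitzBound f ≤ ENNReal.ofReal b := sInf_le fun x y => by
    rw [edist_dist, edist_dist, ← ENNReal.ofReal_mul' dist_nonneg]
    exact ENNReal.ofReal_le_ofReal (hf' x y)
  have h₃ : 0 < ENNReal.ofReal a := ENNReal.ofReal_pos.2 ha
  rw [distortion, if_neg (not_or.2 ⟨(h₃.trans_le h₁).ne', (h₂.trans_lt ENNReal.ofReal_lt_top).ne⟩),
    ENNReal.ofReal_div_of_pos ha]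
  exact ENNReal.div_le_div h₂ h₁

theorem lowerLipschitzBound_mul_edist_le (f : X → Y) (x y : X) :
    lowerLipschitzBound f * edist x y ≤ edist (f x) (f y) := by
  rw [lowerLipschitzBound, ENNReal.sSup_mul]
  exact iSup₂_le fun a ha => ha x y

theorem edist_le_upperLipschitzBound_mul (f : X → Y) (h : upperLipschitzBound f ≠ ∞) (x y : X) :
    edist (f x) (f y) ≤ upperLipschitzBound f * edist x y := by
  by_cases h₀ : edist x y = 0
  · obtain ⟨b, hb, -⟩ := sInf_lt_iff.1 (lt_top_iff_ne_top.2 h)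
    have h₁ := hb x y
    rw [h₀, mul_zero] at h₁ ⊢
    exact h₁
  · rw [← ENNReal.div_le_iff h₀ (edist_ne_top _ _)]
    exact le_sInf fun b hb => ENNReal.div_le_of_le_mul (hb x y)

/-- The pair at positive distance excludes an infinite lower Lipschitz bound, which would spoil the
quotient. -/
theorem ofReal_le_distortion {f : X → Y} {c : ℝ} {x₀ y₀ : X} (h₀ : 0 < dist x₀ y₀)
    (h : ∀ a b : ℝ, 0 < a → 0 ≤ b → (∀ x y, a * dist x y ≤ dist (f x) (f y)) →
      (∀ x y, dist (f x) (f y) ≤ b * dist x y) → c * a ≤ b) :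
    ENNReal.ofReal c ≤ distortion f := by
  rw [distortion]
  split_ifs with hf
  · exact le_top
  obtain ⟨ha, hb⟩ := not_or.1 hf
  have hlow := lowerLipschitzBound_mul_edist_le f
  have hup := edist_le_upperLipschitzBound_mul f hb
  have ha' : lowerLipschitzBound f ≠ ∞ := fun htop => by
    have h₁ := hlow x₀ y₀
    rw [htop, ENNReal.top_mul (by rw [edist_dist]; simpa using h₀)] at h₁
    exact edist_ne_top _ _ (top_le_iff.1 h₁)
  have key := h (lowerLipschitzBound f).toReal (upperLipschitzBound f).toReal
    (ENNReal.toReal_pos ha ha') ENNReal.toReal_nonneg (fun x y => by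
      rw [dist_edist, dist_edist, ← ENNReal.toReal_mul]
      exact ENNReal.toReal_mono (edist_ne_top _ _) (hlow x y)) (fun x y => by
      rw [dist_edist, dist_edist, ← ENNReal.toReal_mul]
      exact ENNReal.toReal_mono (ENNReal.mul_ne_top hb (edist_ne_top _ _)) (hup x y))
  rw [ENNReal.le_div_iff_mul_le (Or.inl ha) (Or.inl ha'), ← ENNReal.ofReal_toReal ha',
    ← ENNReal.ofReal_toReal hb, ← ENNReal.ofReal_mul' ENNReal.toReal_nonneg]
  exact ENNReal.ofReal_le_ofReal key

end Distortion

theorem euclideanDistortion_le_distortion {X H : Type u} [PseudoMetricSpace X]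
    [i₁ : NormedAddCommGroup H] [i₂ : InnerProductSpace ℝ H] [i₃ : CompleteSpace H] (f : X → H) :
    euclideanDistortion X ≤ distortion f :=
  iInf_le_of_le H <| iInf_le_of_le i₁ <| iInf_le_of_le i₂ <| iInf_le_of_le i₃ <| iInf_le _ f

theorem ofReal_le_euclideanDistortion {X : Type u} [PseudoMetricSpace X] {c : ℝ} {x₀ y₀ : X}
    (h₀ : 0 < dist x₀ y₀)
    (h : ∀ (H : Type u) [NormedAddCommGroup H] [InnerProductSpace ℝ H] (f : X → H) (a b : ℝ),
      0 < a → 0 ≤ b → (∀ x y, a * dist x y ≤ dist (f x) (f y)) →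
      (∀ x y, dist (f x) (f y) ≤ b * dist x y) → c * a ≤ b) :
    ENNReal.ofReal c ≤ euclideanDistortion X :=
  le_iInf fun H => le_iInf fun i₁ => le_iInf fun i₂ => le_iInf fun _ => le_iInf fun f =>
    ofReal_le_distortion h₀ (@h H i₁ i₂ f)

theorem OrbitSpace.eq_of_dist_eq_zero {G X : Type*} [Group G] [Finite G] [MetricSpace X]
    [MulAction G X] [IsIsometricSMul G X] {a b : OrbitSpace G X} (h : dist a b = 0) : a = b := by
  induction a using Quotient.inductionOn' with
  | h x =>
  induction b using Quotient.inductionOn' with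
  | h y =>
  change mk G x = mk G y
  obtain ⟨g, hg⟩ := Finite.exists_min fun g : G => dist x (g • y)
  have h₁ : dist x (g • y) ≤ dist (mk G x) (mk G y) := le_dist_mk hg
  rw [dist_le_zero.1 (h₁.trans_eq h), mk_smul]

/-! ### The orbit space as a double, and its embedding with distortion at most 2 -/

namespace WeylChamber

variable {V : Type*} [NormedAddCommGroup V] [InnerProductSpace ℝ V] [FiniteDimensional ℝ V]
  {R : Subgroup (V ≃ₗᵢ[ℝ] V)} [Finite R] (C : WeylChamber R)

/-- The map from two copies of the chamber to the orbit space of the alternating subgroup: the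
identity on the first one, a reflection on the second one. -/
noncomputable def doubleMap (α : V) : C.carrier ⊕ C.carrier → OrbitSpace (alternatingSubgroup R) V :=
  Sum.elim (fun y => OrbitSpace.mk _ (y : V))
    (fun y => OrbitSpace.mk _ (hyperplaneReflection α (y : V)))

variable {C} {α : V}

theorem dist_doubleMap (hR : IsReflectionGroup R) (hα : α ∈ C.simpleRoots)
    (p q : C.carrier ⊕ C.carrier) : dist (C.doubleMap α p) (C.doubleMap α q) =
      Metric.glueDist (Subtype.val : C.boundary → C.carrier) Subtype.val 0 p q := by
  rcases p with y | y <;> rcases q with y' | y'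
  · exact dist_mk_mk hR y.2 y'.2
  · exact (dist_mk_mk_reflection hR hα y.2 y'.2).trans (add_zero _).symm
  · exact ((dist_comm _ _).trans (dist_mk_mk_reflection hR hα y'.2 y.2)).trans (add_zero _).symm
  · exact dist_mk_reflection_mk_reflection hR hα y.2 y'.2

theorem surjective_doubleMap (hα : α ∈ C.simpleRoots) : Function.Surjective (C.doubleMap α) := by
  intro a
  induction a using Quotient.inductionOn' with
  | h v =>
  obtain ⟨g, hg, hgv⟩ := C.exists_map_mem v
  by_cases h : g ∈ alternatingSubgroup R
  · exact ⟨Sum.inl ⟨g v, hgv⟩, OrbitSpace.mk_smul (⟨g, h⟩ : alternatingSubgroup R) v⟩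
  · exact ⟨Sum.inr ⟨g v, hgv⟩, OrbitSpace.mk_smul
      (⟨_, hyperplaneReflection_mul_mem_alternatingSubgroup hα.1 hg h⟩ : alternatingSubgroup R) v⟩

instance : Finite (alternatingSubgroup R) :=
  Finite.of_injective _ (Subgroup.inclusion_injective (inf_le_left : alternatingSubgroup R ≤ R))

/-- Orbit space and glued space are both quotients of two copies of the chamber realizing the same
pseudodistance `Metric.glueDist` with ε = 0. A section of one projection followed by the other is
therefore an isometry, bijective because both spaces separate points. -/
theorem nonempty_isometryEquiv_gluedDouble (hR : IsReflectionGroup R) (hα : α ∈ C.simpleRoots)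
    [Nonempty C.boundary] :
    Nonempty (OrbitSpace (alternatingSubgroup R) V ≃ᵢ GluedDouble C.boundary) := by
  let π : C.carrier ⊕ C.carrier → GluedDouble C.boundary := fun p => Quotient.mk'' p
  have hπ : ∀ p q, dist (π p) (π q) = dist (C.doubleMap α p) (C.doubleMap α q) := fun p q =>
    (dist_doubleMap hR hα p q).symm
  obtain ⟨r, hr⟩ := (surjective_doubleMap hα).hasRightInverse
  have hiso : Isometry (π ∘ r) := Isometry.of_dist_eq fun a b => by
    rw [Function.comp, Function.comp, hπ, hr, hr]
  refine ⟨⟨Equiv.ofBijective (π ∘ r) ⟨fun a b hab => ?_, fun q => ?_⟩, hiso⟩⟩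
  · exact OrbitSpace.eq_of_dist_eq_zero (by rw [← hiso.dist_eq, hab, dist_self])
  · induction q using Quotient.inductionOn' with
    | h p =>
    refine ⟨C.doubleMap α p, dist_le_zero.1 ?_⟩
    change dist (π _) (π p) ≤ 0
    rw [hπ, hr, dist_self]

/-- The height function over the chamber is the distance to its boundary. -/
noncomputable def boundaryDist (C : WeylChamber R) (y : V) : ℝ :=
  Metric.infDist y (frontier C.carrier)

omit [FiniteDimensional ℝ V] [Finite R] in
theorem boundaryDist_add_le [Nonempty C.boundary] (y y' : C.carrier) :
    C.boundaryDist y + C.boundaryDist y' ≤ ⨅ z : C.boundary, (dist y z.1 + dist y' z.1 : ℝ) :=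
  le_ciInf fun z => add_le_add (Metric.infDist_le_dist_of_mem z.2)
    (Metric.infDist_le_dist_of_mem z.2)

omit [FiniteDimensional ℝ V] [Finite R] in
-- A path may run from y to a nearly closest boundary point, back to y, and on to y'.
theorem iInf_boundary_le [Nonempty C.boundary] (y y' : C.carrier) :
    (⨅ z : C.boundary, (dist y z.1 + dist y' z.1 : ℝ)) ≤ dist y y' + 2 * C.boundaryDist y := by
  set D := ⨅ z : C.boundary, (dist y z.1 + dist y' z.1 : ℝ) with hD
  have h : (D - dist y y') / 2 ≤ C.boundaryDist y := by
    obtain ⟨z₀⟩ := ‹Nonempty C.boundary›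
    refine (Metric.le_infDist (s := frontier C.carrier) ⟨(z₀ : C.carrier), z₀.2⟩).2 fun z hz => ?_
    have h₁ : D ≤ dist (y : V) z + dist (y' : V) z := ciInf_le
      (f := fun z : C.boundary => (dist y z.1 + dist y' z.1 : ℝ))
      ⟨0, by rintro _ ⟨z, rfl⟩; positivity⟩ ⟨⟨z, isClosed_carrier.frontier_subset hz⟩, hz⟩
    have h₂ := dist_triangle (y' : V) y z
    have h₃ : dist y y' = dist (y' : V) y := dist_comm (y : V) y'
    linarith
  linarith

/-- The map `(y, ±) ↦ (y, ± d(y, ∂C))`. -/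
noncomputable def doubleEmbedding (C : WeylChamber R) :
    C.carrier ⊕ C.carrier → WithLp 2 (V × ℝ) :=
  Sum.elim (fun y => WithLp.toLp 2 ((y : V), C.boundaryDist y))
    (fun y => WithLp.toLp 2 ((y : V), -C.boundaryDist y))

/-- This compares the Euclidean norm of (d, t) with the maximum norm, bounded by D, and with the sum
norm, which bounds D. -/
theorem sqrt_bounds {d t D : ℝ} (hd : 0 ≤ d) (hD : 0 ≤ D) (hdD : d ≤ D)
    (htD : |t| ≤ D) (hDt : D ≤ d + |t|) :
    √(d ^ 2 + t ^ 2) ≤ √2 * D ∧ D ≤ √2 * √(d ^ 2 + t ^ 2) := by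
  have ht := abs_nonneg t
  rw [← sq_abs t]
  constructor
  · refine Real.sqrt_le_iff.2 ⟨by positivity, ?_⟩
    rw [mul_pow, Real.sq_sqrt zero_le_two]
    nlinarith
  · rw [← Real.sqrt_mul zero_le_two]
    refine Real.le_sqrt_of_sq_le ?_
    nlinarith [sq_nonneg (d - |t|)]

omit [FiniteDimensional ℝ V] [Finite R] in
-- On one sheet D = d, and |t| ≤ d because the boundary distance is 1-Lipschitz. On opposite sheets
-- |t| is the sum of the heights, and averaging the two detours at y and at y' gives D ≤ d + |t|.
theorem dist_doubleEmbedding [Nonempty C.boundary] (p q : C.carrier ⊕ C.carrier) :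
    dist (C.doubleEmbedding p) (C.doubleEmbedding q) ≤
        √2 * Metric.glueDist (Subtype.val : C.boundary → C.carrier) Subtype.val 0 p q ∧
      Metric.glueDist (Subtype.val : C.boundary → C.carrier) Subtype.val 0 p q ≤
        √2 * dist (C.doubleEmbedding p) (C.doubleEmbedding q) := by
  have hsame : ∀ y y' : C.carrier, ∀ s : ℝ, |s| = |C.boundaryDist y - C.boundaryDist y'| →
      √(dist y y' ^ 2 + s ^ 2) ≤ √2 * dist y y' ∧ dist y y' ≤ √2 * √(dist y y' ^ 2 + s ^ 2) :=
    fun y y' s hs => sqrt_bounds dist_nonneg dist_nonneg le_rfl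
      (hs.le.trans ((Metric.lipschitz_infDist_pt _).dist_le_mul _ _ |>.trans_eq (by simp; rfl))) (le_add_of_nonneg_right (abs_nonneg _))
  have hdiff : ∀ y y' : C.carrier, ∀ s : ℝ, |s| = C.boundaryDist y + C.boundaryDist y' →
      √(dist y y' ^ 2 + s ^ 2) ≤ √2 * ⨅ z : C.boundary, (dist y z.1 + dist y' z.1 : ℝ) ∧
      (⨅ z : C.boundary, (dist y z.1 + dist y' z.1 : ℝ)) ≤ √2 * √(dist y y' ^ 2 + s ^ 2) := by
    intro y y' s hs
    have h₁ := iInf_boundary_le y y'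
    have h₂ := iInf_boundary_le y' y
    rw [dist_comm y' y] at h₂
    simp only [add_comm (dist y' _)] at h₂
    refine sqrt_bounds dist_nonneg (Real.iInf_nonneg fun z => by positivity)
      (le_ciInf fun z => dist_triangle_right _ _ _) (hs.le.trans (boundaryDist_add_le y y')) ?_
    rw [hs]
    linarith
  have hnn : ∀ y : V, 0 ≤ C.boundaryDist y := fun y => Metric.infDist_nonneg
  rcases p with y | y <;> rcases q with y' | y' <;>
    rw [WithLp.prod_dist_eq_of_L2] <;>
    simp only [Metric.glueDist, add_zero, Real.dist_eq, sq_abs, doubleEmbedding, Sum.elim_inl,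
      Sum.elim_inr]
  · exact hsame y y' _ rfl
  · refine hdiff y y' _ ?_
    change |C.boundaryDist y - -C.boundaryDist y'| = _
    rw [sub_neg_eq_add, abs_of_nonneg (add_nonneg (hnn _) (hnn _))]
  · have := hdiff y' y (-C.boundaryDist y - C.boundaryDist y') (by
      rw [← neg_add', abs_neg, abs_of_nonneg (add_nonneg (hnn _) (hnn _)), add_comm])
    rw [dist_comm y' y] at this
    exact this
  · refine hsame y y' _ ?_
    change |-C.boundaryDist y - -C.boundaryDist y'| = _
    rw [neg_sub_neg, abs_sub_comm]

theorem euclideanDistortion_le_two_of_simpleRoots (hR : IsReflectionGroup R)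
    (hα : α ∈ C.simpleRoots) :
    euclideanDistortion (OrbitSpace (alternatingSubgroup R) V) ≤ 2 := by
  have := nonempty_boundary hα
  have : CompleteSpace V := FiniteDimensional.complete ℝ V
  obtain ⟨r, hr⟩ := (surjective_doubleMap hα).hasRightInverse
  have hdist : ∀ a b, dist a b =
      Metric.glueDist (Subtype.val : C.boundary → C.carrier) Subtype.val 0 (r a) (r b) :=
    fun a b => by rw [← dist_doubleMap hR hα, hr, hr]
  have h2 : 0 < √2 := Real.sqrt_pos.2 two_pos
  refine (euclideanDistortion_le_distortion fun a => C.doubleEmbedding (r a)).trans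
    ((distortion_le_of_dist_le (a := (√2)⁻¹) (b := √2) (by positivity) (fun a b => ?_)
      fun a b => ?_).trans_eq ?_)
  · rw [hdist, inv_mul_le_iff₀ h2]
    exact (dist_doubleEmbedding _ _).2
  · rw [hdist]
    exact (dist_doubleEmbedding _ _).1
  · rw [div_inv_eq_mul, Real.mul_self_sqrt zero_le_two, ENNReal.ofReal_ofNat]

theorem euclideanDistortion_le_two (C : WeylChamber R) (hR : IsReflectionGroup R) :
    euclideanDistortion (OrbitSpace (alternatingSubgroup R) V) ≤ 2 := by
  -- For the trivial group the chamber is all of V, and a section of the orbit map is an isometry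
  -- into V.
  by_cases hne : R = ⊥
  · have : CompleteSpace V := FiniteDimensional.complete ℝ V
    have hsurj : Function.Surjective (OrbitSpace.mk (alternatingSubgroup R) (X := V)) :=
      Quotient.mk_surjective
    obtain ⟨r, hr⟩ := hsurj.hasRightInverse
    have hC : ∀ v, v ∈ C.carrier := fun v => by
      obtain ⟨g, hg, hgv⟩ := C.exists_map_mem v
      rw [hne, Subgroup.mem_bot] at hg
      rwa [hg] at hgv
    have hdist : ∀ a b, dist a b = dist (r a) (r b) := fun a b => by
      rw [← dist_mk_mk hR (hC (r a)) (hC (r b)), hr, hr]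
    refine (euclideanDistortion_le_distortion r).trans
      ((distortion_le_of_dist_le (a := 1) (b := 1) one_pos (fun a b => ?_)
        fun a b => ?_).trans ?_)
    · rw [hdist, one_mul]
    · rw [hdist, one_mul]
    · simp
  · obtain ⟨α, hα⟩ := nonempty_simpleRoots (C := C) hR hne
    exact euclideanDistortion_le_two_of_simpleRoots hR hα

end WeylChamber

/-! ### Closed polygons in inner product spaces -/

section Polygon

open InnerProductGeometry

theorem Function.Periodic.sum_range_add {N : ℕ} {h : ℕ → ℝ} (hh : Function.Periodic h N) (k : ℕ) :
    ∑ i ∈ Finset.range N, h (i + k) = ∑ i ∈ Finset.range N, h i := by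
  induction k with
  | zero => rfl
  | succ k ih =>
    rw [← ih]
    have h₁ := Finset.sum_range_succ (fun i => h (i + k)) N
    have h₂ := Finset.sum_range_succ' (fun i => h (i + k)) N
    have h₃ : h (N + k) = h (0 + k) := by rw [zero_add, add_comm]; exact hh k
    have h₄ : ∀ i, h (i + 1 + k) = h (i + (k + 1)) := fun i => by rw [add_assoc, add_comm 1 k]
    simp only [h₄] at h₂
    linarith

theorem angle_le_nat_mul {E : Type*} [NormedAddCommGroup E] [InnerProductSpace ℝ E] {G : ℕ → E}
    {θ : ℝ} (hG0 : G 0 ≠ 0) (h : ∀ k, angle (G k) (G (k + 1)) ≤ θ) (k : ℕ) :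
    angle (G 0) (G k) ≤ k * θ := by
  induction k with
  | zero => rw [angle_self hG0]; simp
  | succ k ih =>
    push_cast
    linarith [angle_le_angle_add_angle (G 0) (G k) (G (k + 1)), h k]

/-- A closed polygon with `2M` vertices in an inner product space whose opposite vertices have
distance at least `D` has an edge of length at least `sin (π / (2M)) * D`. -/
theorem sin_mul_le_of_closed_polygon {H : Type*} [NormedAddCommGroup H] [InnerProductSpace ℝ H]
    {f : ℕ → H} {M : ℕ} (hM : 0 < M) (hf : Function.Periodic f (2 * M)) {δ D : ℝ} (hD : 0 < D)
    (hδ : ∀ i, ‖f (i + 1) - f i‖ ≤ δ) (hfD : ∀ i, D ≤ ‖f (i + M) - f i‖) :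
    Real.sin (Real.pi / (2 * M)) * D ≤ δ := by
  -- Differences of opposite vertices change sign after M steps.
  set g : ℕ → H := fun i => f (i + M) - f i with hg
  have hgM : ∀ i, g (i + M) = -g i := fun i => by
    simp only [hg]
    rw [add_assoc, ← two_mul, hf i, neg_sub]
  have hg2M : Function.Periodic g (2 * M) := fun i => by
    rw [two_mul, ← add_assoc, hgM, hgM, neg_neg]
  have hgδ : ∀ i, ‖g i - g (i + 1)‖ ≤ 2 * δ := fun i => by
    have h₁ : g i - g (i + 1) = (f (i + 1) - f i) - (f (i + M + 1) - f (i + M)) := by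
      simp only [hg]
      rw [add_right_comm i 1 M]
      abel
    rw [h₁]
    linarith [norm_sub_le (f (i + 1) - f i) (f (i + M + 1) - f (i + M)), hδ i, hδ (i + M)]
  -- All cyclic shifts of g as vectors of the 2M-fold sum of H. They have equal norms and equal
  -- consecutive angles, so the estimates on all vertices are averaged at once.
  let G : ℕ → PiLp 2 (fun _ : Fin (2 * M) => H) := fun k => WithLp.toLp 2 fun j => g (j + k)
  have hinner : ∀ k l, inner ℝ (G k) (G (k + l)) = inner ℝ (G 0) (G l) := fun k l => by
    rw [PiLp.inner_apply, PiLp.inner_apply]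
    have h₁ := Function.Periodic.sum_range_add (N := 2 * M)
      (h := fun i => (inner ℝ (g i) (g (i + l)) : ℝ)) (fun i => by
        simp only
        rw [hg2M, add_right_comm, hg2M]) k
    rw [← Fin.sum_univ_eq_sum_range, ← Fin.sum_univ_eq_sum_range] at h₁
    simpa only [G, add_zero, add_assoc] using h₁
  have hnorm : ∀ k, ‖G k‖ = ‖G 0‖ := fun k => by
    have h₁ := hinner k 0
    rw [add_zero, real_inner_self_eq_norm_sq, real_inner_self_eq_norm_sq] at h₁
    exact (sq_eq_sq₀ (norm_nonneg _) (norm_nonneg _)).1 h₁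
  have hangle : ∀ k, angle (G k) (G (k + 1)) = angle (G 0) (G 1) := fun k => by
    rw [angle, angle, hinner, hnorm k, hnorm (k + 1), hnorm 1]
  have hMr : (0 : ℝ) < M := Nat.cast_pos.2 hM
  have hG0 : 2 * M * D ^ 2 ≤ ‖G 0‖ ^ 2 := by
    rw [PiLp.norm_sq_eq_of_L2]
    have h₁ : ∀ i ∈ (Finset.univ : Finset (Fin (2 * M))), D ^ 2 ≤ ‖G 0 i‖ ^ 2 :=
      fun i _ => pow_le_pow_left₀ hD.le (hfD _) 2
    have h₂ := Finset.card_nsmul_le_sum _ _ _ h₁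
    simpa using h₂
  have hG0' : G 0 ≠ 0 := fun h => by
    rw [h, norm_zero] at hG0
    have : 0 < 2 * M * D ^ 2 := by positivity
    linarith
  have hG1 : ‖G 0 - G 1‖ ^ 2 ≤ 2 * M * (2 * δ) ^ 2 := by
    rw [PiLp.norm_sq_eq_of_L2]
    have h₁ : ∀ i ∈ (Finset.univ : Finset (Fin (2 * M))), ‖(G 0 - G 1) i‖ ^ 2 ≤ (2 * δ) ^ 2 :=
      fun i _ => pow_le_pow_left₀ (norm_nonneg _) (hgδ _) 2
    have h₂ := Finset.sum_le_card_nsmul _ _ _ h₁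
    simpa using h₂
  have hGM : G M = -G 0 := by
    ext j
    exact hgM j
  -- M equal angular steps lead from G 0 to -G 0, so each is at least π/M.
  have hθ : Real.pi / M ≤ angle (G 0) (G 1) := by
    have h₁ := angle_le_nat_mul hG0' (fun k => (hangle k).le) M
    rw [hGM, angle_self_neg_of_nonzero hG0'] at h₁
    rwa [div_le_iff₀' hMr]
  have hcos : inner ℝ (G 0) (G 1) ≤ Real.cos (Real.pi / M) * ‖G 0‖ ^ 2 := by
    rw [← cos_angle_mul_norm_mul_norm, hnorm 1, sq]
    gcongr
    exact Real.cos_le_cos_of_nonneg_of_le_pi (by positivity) (angle_le_pi _ _) hθ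
  have hsub : 4 * Real.sin (Real.pi / (2 * M)) ^ 2 * ‖G 0‖ ^ 2 ≤ ‖G 0 - G 1‖ ^ 2 := by
    rw [norm_sub_sq_real, hnorm 1]
    have h₁ : Real.cos (Real.pi / M) = 1 - 2 * Real.sin (Real.pi / (2 * M)) ^ 2 := by
      rw [show Real.pi / M = 2 * (Real.pi / (2 * M)) by field_simp, Real.cos_two_mul,
        Real.cos_sq']
      ring
    rw [h₁] at hcos
    linarith
  have hδ0 : 0 ≤ δ := (norm_nonneg _).trans (hδ 0)
  refine abs_le_of_sq_le_sq' ?_ hδ0 |>.2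
  have h₁ : 4 * Real.sin (Real.pi / (2 * M)) ^ 2 * (2 * M * D ^ 2) ≤ 2 * M * (2 * δ) ^ 2 :=
    (mul_le_mul_of_nonneg_left hG0 (by positivity)).trans (hsub.trans hG1)
  have h₂ : 8 * M * (Real.sin (Real.pi / (2 * M)) * D) ^ 2 ≤ 8 * M * δ ^ 2 := by linarith
  exact le_of_mul_le_mul_left h₂ (by positivity)

end Polygon

/-- Concavity of the sine on [0, π], which vanishes at 0, applied at k/n times π/(2k). -/
theorem mul_sin_pi_div_mono {k n : ℕ} (hk : 0 < k) (hkn : k ≤ n) :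
    k * Real.sin (Real.pi / (2 * k)) ≤ n * Real.sin (Real.pi / (2 * n)) := by
  have hk' : (1 : ℝ) ≤ k := by exact_mod_cast hk
  have hkn' : (k : ℝ) ≤ n := by exact_mod_cast hkn
  have hn0 : (0 : ℝ) < n := by linarith
  have hπ := Real.pi_pos
  have hmem : Real.pi / (2 * k) ∈ Set.Icc 0 Real.pi :=
    ⟨by positivity, by rw [div_le_iff₀ (by positivity)]; nlinarith⟩
  have h := strictConcaveOn_sin_Icc.concaveOn.2 hmem (Set.left_mem_Icc.2 hπ.le)
    (show 0 ≤ (k : ℝ) / n by positivity)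
    (show 0 ≤ 1 - (k : ℝ) / n by rw [sub_nonneg, div_le_one hn0]; exact hkn')
    (add_sub_cancel _ _)
  simp only [smul_eq_mul, Real.sin_zero, mul_zero, add_zero] at h
  have h₁ : (k : ℝ) / n * (Real.pi / (2 * k)) = Real.pi / (2 * n) := by field_simp
  rw [h₁, div_mul_eq_mul_div, div_le_iff₀ hn0] at h
  linarith

/-! ### Circles in the plane of two roots -/

section Circle

variable {V : Type*} [NormedAddCommGroup V] [InnerProductSpace ℝ V]

/-- The point with angle `t` on the unit circle of the plane spanned by `e` and `α`. -/
noncomputable def circlePoint (e α : V) (t : ℝ) : V := Real.cos t • e + Real.sin t • α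

variable {e α β : V} {φ : ℝ}

theorem inner_circlePoint (he : ‖e‖ = 1) (hα : ‖α‖ = 1) (h : inner ℝ e α = 0) (s t : ℝ) :
    inner ℝ (circlePoint e α s) (circlePoint e α t) = Real.cos (s - t) := by
  have h' : inner ℝ α e = 0 := by rw [real_inner_comm, h]
  simp only [circlePoint, inner_add_left, inner_add_right, real_inner_smul_left,
    real_inner_smul_right, real_inner_self_eq_norm_sq, he, hα, h, h', Real.cos_sub]
  ring

theorem norm_circlePoint (he : ‖e‖ = 1) (hα : ‖α‖ = 1) (h : inner ℝ e α = 0) (t : ℝ) :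
    ‖circlePoint e α t‖ = 1 := by
  have h₁ := inner_circlePoint he hα h t t
  rw [real_inner_self_eq_norm_sq, sub_self, Real.cos_zero] at h₁
  exact (pow_eq_one_iff_of_nonneg (norm_nonneg _) two_ne_zero).1 h₁

theorem dist_circlePoint (he : ‖e‖ = 1) (hα : ‖α‖ = 1) (h : inner ℝ e α = 0) (s t : ℝ) :
    dist (circlePoint e α s) (circlePoint e α t) = 2 * |Real.sin ((s - t) / 2)| := by
  rw [dist_eq_norm]
  refine (sq_eq_sq₀ (norm_nonneg _) (by positivity)).1 ?_
  rw [norm_sub_sq_real, norm_circlePoint he hα h, norm_circlePoint he hα h,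
    inner_circlePoint he hα h, mul_pow, sq_abs, show s - t = 2 * ((s - t) / 2) by ring,
    Real.cos_two_mul, Real.cos_sq']
  ring_nf

theorem inner_left_circlePoint (hα : ‖α‖ = 1) (h : inner ℝ e α = 0) (t : ℝ) :
    inner ℝ α (circlePoint e α t) = Real.sin t := by
  have h' : inner ℝ α e = 0 := by rw [real_inner_comm, h]
  simp [circlePoint, inner_add_right, real_inner_smul_right, hα, h']

theorem inner_right_circlePoint (he : ‖e‖ = 1) (hα : ‖α‖ = 1) (h : inner ℝ e α = 0)
    (hβ : β = Real.sin φ • e - Real.cos φ • α) (t : ℝ) :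
    inner ℝ β (circlePoint e α t) = Real.sin (φ - t) := by
  have h' : inner ℝ α e = 0 := by rw [real_inner_comm, h]
  simp only [circlePoint, hβ, inner_sub_left, inner_add_right, real_inner_smul_left,
    real_inner_smul_right, real_inner_self_eq_norm_sq, he, hα, h, h', Real.sin_sub]
  ring

theorem hyperplaneReflection_left_circlePoint (hα : ‖α‖ = 1) (h : inner ℝ e α = 0) (t : ℝ) :
    hyperplaneReflection α (circlePoint e α t) = circlePoint e α (-t) := by
  rw [hyperplaneReflection_apply hα, inner_left_circlePoint hα h, circlePoint, circlePoint,
    Real.cos_neg, Real.sin_neg]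
  module

theorem hyperplaneReflection_right_circlePoint (he : ‖e‖ = 1) (hα : ‖α‖ = 1)
    (h : inner ℝ e α = 0) (hβ1 : ‖β‖ = 1) (hβ : β = Real.sin φ • e - Real.cos φ • α) (t : ℝ) :
    hyperplaneReflection β (circlePoint e α t) = circlePoint e α (2 * φ - t) := by
  rw [hyperplaneReflection_apply hβ1, inner_right_circlePoint he hα h hβ]
  obtain ⟨s, rfl⟩ : ∃ s, t = φ - s := ⟨φ - t, by ring⟩
  rw [show 2 * φ - (φ - s) = φ + s by ring, sub_sub_cancel, circlePoint, circlePoint, hβ,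
    Real.cos_sub, Real.sin_sub, Real.cos_add, Real.sin_add]
  module

/-- Two unit vectors at an obtuse angle, in terms of an orthonormal basis of their plane. -/
theorem exists_orthonormal_of_inner_nonpos (hα : ‖α‖ = 1) (hβ : ‖β‖ = 1) (h : inner ℝ α β ≤ 0)
    (hne : β ≠ -α) : ∃ (e : V) (φ : ℝ), ‖e‖ = 1 ∧ inner ℝ e α = 0 ∧ 0 < φ ∧ φ ≤ Real.pi / 2 ∧
      β = Real.sin φ • e - Real.cos φ • α := by
  set c : ℝ := inner ℝ α β with hc
  have hc1 : -1 < c := by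
    refine lt_of_le_of_ne ?_ fun h₁ => hne ?_
    · have := abs_real_inner_le_norm α β
      rw [hα, hβ, one_mul] at this
      exact (abs_le.1 this).1
    · have h₂ : inner ℝ β (-α) = (1 : ℝ) := by rw [inner_neg_right, real_inner_comm]; linarith
      exact (inner_eq_one_iff_of_norm_eq_one (𝕜 := ℝ) hβ (by rwa [norm_neg])).1 h₂
  -- The angle between the walls, which is π minus the angle between the roots.
  set φ := Real.arccos (-c) with hφ
  have hcos : Real.cos φ = -c := Real.cos_arccos (by linarith) (by linarith)
  have hφ0 : 0 < φ := Real.arccos_pos.2 (by linarith)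
  have hφ1 : φ ≤ Real.pi / 2 := Real.arccos_le_pi_div_two.2 (by linarith)
  have hsin : 0 < Real.sin φ := Real.sin_pos_of_pos_of_lt_pi hφ0 (by linarith [Real.pi_pos])
  have hβα : inner ℝ β α = c := real_inner_comm _ _
  refine ⟨(Real.sin φ)⁻¹ • (β + Real.cos φ • α), φ, ?_, ?_, hφ0, hφ1, ?_⟩
  · have h₁ : ‖β + Real.cos φ • α‖ ^ 2 = Real.sin φ ^ 2 := by
      rw [norm_add_sq_real, norm_smul, hα, hβ, real_inner_smul_right, hβα, Real.norm_eq_abs,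
        mul_one, sq_abs, Real.sin_sq, hcos]
      ring
    rw [norm_smul, (sq_eq_sq₀ (norm_nonneg _) hsin.le).1 h₁, Real.norm_eq_abs,
      abs_of_pos (inv_pos.2 hsin), inv_mul_cancel₀ hsin.ne']
  · rw [real_inner_smul_left, inner_add_left, real_inner_smul_left, real_inner_self_eq_norm_sq, hα,
      hβα, hcos]
    ring
  · rw [smul_inv_smul₀ hsin.ne', add_sub_cancel_right]

end Circle

/-- The prescribed values define a functional on the span; extend it and represent it by a vector.
-/
theorem LinearIndependent.exists_inner_eq {ι V : Type*} [NormedAddCommGroup V]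
    [InnerProductSpace ℝ V] [FiniteDimensional ℝ V] {v : ι → V} (hv : LinearIndependent ℝ v)
    (c : ι → ℝ) : ∃ z : V, ∀ i, inner ℝ (v i) z = c i := by
  have : CompleteSpace V := FiniteDimensional.complete ℝ V
  obtain ⟨L, hL⟩ := LinearMap.exists_extend ((Module.Basis.span hv).constr ℝ c)
  refine ⟨(InnerProductSpace.toDual ℝ V).symm (LinearMap.toContinuousLinearMap L), fun i => ?_⟩
  rw [real_inner_comm, InnerProductSpace.toDual_symm_apply, LinearMap.coe_toContinuousLinearMap',
    ← (Module.Basis.span hv).constr_basis ℝ c i, ← hL, LinearMap.comp_apply, Submodule.subtype_apply,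
    Module.Basis.span_apply]

/-! ### The circle around a codimension-two face and its image in the orbit space -/

namespace WeylChamber

variable {V : Type*} [NormedAddCommGroup V] [InnerProductSpace ℝ V]
  {R : Subgroup (V ≃ₗᵢ[ℝ] V)} {C : WeylChamber R}

/-- A circle in the plane of two simple roots, centered at a point of the chamber that is on the
hyperplanes of these roots and far away from the other facets. -/
structure SimplePair (C : WeylChamber R) (α β e z : V) (φ : ℝ) : Prop where
  left_mem : α ∈ C.simpleRoots
  right_mem : β ∈ C.simpleRoots
  norm_eq : ‖e‖ = 1
  inner_eq : inner ℝ e α = 0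
  angle_pos : 0 < φ
  angle_le : φ ≤ Real.pi / 2
  right_eq : β = Real.sin φ • e - Real.cos φ • α
  inner_left : inner ℝ α z = 0
  inner_right : inner ℝ β z = 0
  inner_other : ∀ γ ∈ C.simpleRoots, γ ≠ α → γ ≠ β → inner ℝ γ z = 3

theorem exists_simplePair [FiniteDimensional ℝ V] {α β : V} (hα : α ∈ C.simpleRoots)
    (hβ : β ∈ C.simpleRoots) (hne : α ≠ β) : ∃ e z φ, SimplePair C α β e z φ := by
  classical
  obtain ⟨e, φ, he, heα, hφ₀, hφ₁, hβe⟩ := exists_orthonormal_of_inner_nonpos hα.1.1 hβ.1.1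
    (inner_nonpos_of_simpleRoots hα hβ hne) fun h =>
      neg_notMem_positiveRoots (simpleRoots_subset hα) (h ▸ simpleRoots_subset hβ)
  obtain ⟨z, hz⟩ := (linearIndependent_simpleRoots (C := C)).exists_inner_eq
    fun γ => if (γ : V) = α ∨ (γ : V) = β then 0 else 3
  exact ⟨e, z, φ, hα, hβ, he, heα, hφ₀, hφ₁, hβe, (hz ⟨α, hα⟩).trans (if_pos (Or.inl rfl)),
    (hz ⟨β, hβ⟩).trans (if_pos (Or.inr rfl)),
    fun γ hγ h₁ h₂ => (hz ⟨γ, hγ⟩).trans (if_neg (not_or.2 ⟨h₁, h₂⟩))⟩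

namespace SimplePair

variable {α β e z : V} {φ : ℝ} (P : SimplePair C α β e z φ)
include P

theorem sin_angle_half_pos : 0 < Real.sin (φ / 2) :=
  Real.sin_pos_of_pos_of_lt_pi (by linarith [P.angle_pos])
    (by linarith [P.angle_le, Real.pi_pos])

theorem dist_eq (s t : ℝ) :
    dist (z + circlePoint e α s) (z + circlePoint e α t) = 2 * |Real.sin ((s - t) / 2)| := by
  rw [dist_add_left, dist_circlePoint P.norm_eq P.left_mem.1.1 P.inner_eq]

theorem dist_angle (t : ℝ) :
    dist (z + circlePoint e α (t + φ)) (z + circlePoint e α t) = 2 * Real.sin (φ / 2) := by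
  rw [P.dist_eq, add_sub_cancel_left, abs_of_pos P.sin_angle_half_pos]

theorem reflection_left (t : ℝ) :
    hyperplaneReflection α (z + circlePoint e α t) = z + circlePoint e α (-t) := by
  rw [map_add, hyperplaneReflection_apply_eq_self P.inner_left,
    hyperplaneReflection_left_circlePoint P.left_mem.1.1 P.inner_eq]

theorem reflection_right (t : ℝ) :
    hyperplaneReflection β (z + circlePoint e α t) = z + circlePoint e α (2 * φ - t) := by
  rw [map_add, hyperplaneReflection_apply_eq_self P.inner_right,
    hyperplaneReflection_right_circlePoint P.norm_eq P.left_mem.1.1 P.inner_eq P.right_mem.1.1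
      P.right_eq]

/-- The product of the two reflections turns the circle by 2φ. -/
theorem rotation_pow (k : ℕ) (t : ℝ) :
    ((hyperplaneReflection β * hyperplaneReflection α) ^ k) (z + circlePoint e α t) =
      z + circlePoint e α (t + 2 * k * φ) := by
  induction k with
  | zero => simp
  | succ k ih =>
    rw [pow_succ']
    change hyperplaneReflection β (hyperplaneReflection α
      (((hyperplaneReflection β * hyperplaneReflection α) ^ k) (z + circlePoint e α t))) = _
    rw [ih, P.reflection_left, P.reflection_right]
    push_cast
    ring_nf

theorem rotation_mem : hyperplaneReflection β * hyperplaneReflection α ∈ R :=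
  R.mul_mem P.right_mem.1.2 P.left_mem.1.2

/-- The height 3 of the center minus the radius 1. The resulting 2 is at least any value 2 sin(φ/2),
so paths through other walls are never too short. -/
theorem two_le_inner_other {γ : V} (hγ : γ ∈ C.simpleRoots) (hγα : γ ≠ α) (hγβ : γ ≠ β) (t : ℝ) :
    2 ≤ inner ℝ γ (z + circlePoint e α t) := by
  have h := abs_real_inner_le_norm γ (circlePoint e α t)
  rw [hγ.1.1, norm_circlePoint P.norm_eq P.left_mem.1.1 P.inner_eq, one_mul] at h
  rw [inner_add_right, P.inner_other γ hγ hγα hγβ]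
  linarith [(abs_le.1 h).1]

theorem inner_left_eq (t : ℝ) : inner ℝ α (z + circlePoint e α t) = Real.sin t := by
  rw [inner_add_right, P.inner_left, inner_left_circlePoint P.left_mem.1.1 P.inner_eq, zero_add]

theorem inner_right_eq (t : ℝ) : inner ℝ β (z + circlePoint e α t) = Real.sin (φ - t) := by
  rw [inner_add_right, P.inner_right,
    inner_right_circlePoint P.norm_eq P.left_mem.1.1 P.inner_eq P.right_eq, zero_add]

variable [Finite R]

theorem circlePoint_mem {t : ℝ} (ht : t ∈ Set.Icc 0 φ) :
    z + circlePoint e α t ∈ C.carrier := by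
  have hφ := P.angle_le
  have hπ := Real.pi_pos
  refine mem_carrier_iff_simpleRoots.2 fun γ hγ => ?_
  by_cases hγα : γ = α
  · rw [hγα, P.inner_left_eq]
    exact Real.sin_nonneg_of_nonneg_of_le_pi ht.1 (by linarith [ht.2])
  by_cases hγβ : γ = β
  · rw [hγβ, P.inner_right_eq]
    exact Real.sin_nonneg_of_nonneg_of_le_pi (by linarith [ht.2]) (by linarith [ht.1])
  · linarith [P.two_le_inner_other hγ hγα hγβ t]

/-- The midpoint of the arc has trivial stabilizer, so a group element can be recognized as 1 by its
action on the circle. -/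
theorem circlePoint_mem_interior : z + circlePoint e α (φ / 2) ∈ interior C.carrier := by
  have hφ := P.angle_pos
  by_contra hint
  obtain ⟨γ, hγ, h₀⟩ := exists_inner_eq_zero_of_mem_frontier (C := C)
    (v := z + circlePoint e α (φ / 2)) (by
      rw [isClosed_carrier.frontier_eq]
      exact ⟨P.circlePoint_mem ⟨by linarith, by linarith⟩, hint⟩)
  by_cases hγα : γ = α
  · rw [hγα, P.inner_left_eq] at h₀
    exact P.sin_angle_half_pos.ne' h₀
  by_cases hγβ : γ = β
  · rw [hγβ, P.inner_right_eq, sub_half] at h₀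
    exact P.sin_angle_half_pos.ne' h₀
  · linarith [P.two_le_inner_other hγ hγα hγβ (φ / 2)]

/-- Rotations that fix the circle are trivial. -/
theorem rotation_pow_eq_one (hR : IsReflectionGroup R) {k : ℕ} {m : ℤ}
    (h : 2 * k * φ = m * (2 * Real.pi)) :
    (hyperplaneReflection β * hyperplaneReflection α) ^ k = 1 := by
  refine eq_one_of_map_eq_self hR P.circlePoint_mem_interior (R.pow_mem P.rotation_mem k) ?_
  rw [P.rotation_pow, h, circlePoint, circlePoint, Real.cos_add_int_mul_two_pi,
    Real.sin_add_int_mul_two_pi]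

/-- The angle between the walls of two simple roots. -/
theorem angle_eq (hR : IsReflectionGroup R) {n : ℕ} (hn : 2 ≤ n)
    (hord : orderOf (hyperplaneReflection β * hyperplaneReflection α) = n) :
    φ = Real.pi / n := by
  have hφ := P.angle_pos
  have hφ' := P.angle_le
  have hπ := Real.pi_pos
  have hn2 : (2 : ℝ) ≤ n := by exact_mod_cast hn
  have hn0 : (0 : ℝ) < n := by linarith
  obtain ⟨m, hm⟩ : ∃ m : ℕ, n * φ = m * Real.pi := by
    have h₁ := P.rotation_pow n 0
    rw [← hord, pow_orderOf_eq_one, hord] at h₁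
    have h₂ := P.dist_eq 0 (0 + 2 * n * φ)
    rw [← h₁, LinearIsometryEquiv.coe_one, id, dist_self] at h₂
    have h₃ : Real.sin (n * φ) = 0 := by
      have h₄ : Real.sin ((0 - (0 + 2 * n * φ)) / 2) = 0 := by
        rw [← abs_eq_zero]; linarith
      rwa [show (0 - (0 + 2 * n * φ)) / 2 = -(n * φ) by ring, Real.sin_neg, neg_eq_zero] at h₄
    obtain ⟨m, hm⟩ := Real.sin_eq_zero_iff.1 h₃
    have hm0 : 0 ≤ m := by
      have : (0 : ℝ) < m := by
        refine pos_of_mul_pos_left (b := Real.pi) ?_ hπ.le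
        rw [hm]; positivity
      exact_mod_cast this.le
    lift m to ℕ using hm0
    exact ⟨m, by rw [← hm]; simp⟩
  -- A common divisor of m and n would make a smaller power of the rotation fix the circle, hence be
  -- trivial, against the order n.
  have hcop : Nat.Coprime m n := by
    set d := Nat.gcd m n with hd
    obtain ⟨m', hm'⟩ : d ∣ m := Nat.gcd_dvd_left m n
    obtain ⟨n', hn'⟩ : d ∣ n := Nat.gcd_dvd_right m n
    have hd0 : 0 < d := Nat.gcd_pos_of_pos_right m (by omega)
    have h₁ : (hyperplaneReflection β * hyperplaneReflection α) ^ n' = 1 := by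
      refine P.rotation_pow_eq_one hR (m := m') ?_
      have hdr : (0 : ℝ) < d := by exact_mod_cast hd0
      have h₂ : (n : ℝ) = d * n' := by exact_mod_cast hn'
      have h₃ : (m : ℝ) = d * m' := by exact_mod_cast hm'
      rw [h₂, h₃] at hm
      have h₄ : (d : ℝ) * (n' * φ) = d * (m' * Real.pi) := by linarith
      have h₅ := mul_left_cancel₀ hdr.ne' h₄
      push_cast
      linarith
    have h₂ : n ∣ n' := hord ▸ orderOf_dvd_of_pow_eq_one h₁
    have hn'0 : 0 < n' := Nat.pos_of_ne_zero fun h => by rw [h] at hn'; omega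
    have h₃ : d * n' ≤ 1 * n' := by rw [← hn', one_mul]; exact Nat.le_of_dvd hn'0 h₂
    exact le_antisymm (le_of_mul_le_mul_right h₃ hn'0) hd0
  -- With j inverse to m modulo n, the j-th power is the rotation by 2π/n.
  obtain ⟨j, hj⟩ := Nat.exists_mul_mod_eq_one_of_coprime hcop (by omega)
  have hjq : m * j = 1 + n * (m * j / n) := by
    have := Nat.mod_add_div (m * j) n
    omega
  have hrot : 2 * j * φ = 2 * Real.pi / n + ((m * j / n : ℕ) : ℤ) * (2 * Real.pi) := by
    have h₁ : (m : ℝ) * j = 1 + n * ((m * j / n : ℕ) : ℝ) := by exact_mod_cast hjq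
    have h₂ : φ = m * Real.pi / n := by rw [← hm]; field_simp
    rw [h₂, Int.cast_natCast]
    field_simp
    linarith
  refine le_antisymm ?_ ?_
  -- If φ > π/n, that rotation carries the arc's endpoint at angle 0 strictly closer to the endpoint
  -- at angle φ, against the nearest-point property.
  · by_contra! hlt
    have h₁ := dist_le_dist_map hR (P.circlePoint_mem (Set.right_mem_Icc.2 hφ.le))
      (P.circlePoint_mem (Set.left_mem_Icc.2 hφ.le)) (R.pow_mem P.rotation_mem j)
    have h₂ : ((hyperplaneReflection β * hyperplaneReflection α) ^ j) (z + circlePoint e α 0) =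
        z + circlePoint e α (2 * Real.pi / n) := by
      rw [P.rotation_pow, zero_add, hrot, circlePoint, circlePoint, Real.cos_add_int_mul_two_pi,
        Real.sin_add_int_mul_two_pi]
    rw [h₂, P.dist_eq, P.dist_eq, sub_zero, abs_of_pos P.sin_angle_half_pos] at h₁
    have h₃ : |Real.sin ((φ - 2 * Real.pi / n) / 2)| < Real.sin (φ / 2) := by
      have h₄ : Real.pi / n ≤ Real.pi / 2 := by gcongr
      have h₅ : 0 < Real.pi / n := by positivity
      have h₆ : (φ - 2 * Real.pi / n) / 2 = φ / 2 - Real.pi / n := by ring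
      rw [h₆, abs_lt, ← Real.sin_neg]
      constructor <;> refine Real.sin_lt_sin_of_lt_of_le_pi_div_two ?_ ?_ ?_ <;> linarith
    linarith
  · have hm1 : (1 : ℝ) ≤ m := by
      have : 0 < m := Nat.pos_of_ne_zero fun h => by
        rw [h, Nat.cast_zero, zero_mul] at hm
        have : 0 < n * φ := by positivity
        linarith
      exact_mod_cast this
    rw [div_le_iff₀ hn0]
    nlinarith

variable [FiniteDimensional ℝ V]

/-- The point at t + φ is the reflection in β of the point at φ - t in the chamber, so the distance
is an infimum over paths through boundary points w. Reflecting the second leg in the wall of α or β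
through w unfolds the path onto a chord of angle φ; if w lies on another wall, the first leg alone
has length at least 2. -/
theorem le_dist_mk (hR : IsReflectionGroup R) {t : ℝ} (ht : t ∈ Set.Icc 0 φ) :
    2 * Real.sin (φ / 2) ≤
      dist (OrbitSpace.mk (alternatingSubgroup R) (z + circlePoint e α (t + φ)))
        (OrbitSpace.mk (alternatingSubgroup R) (z + circlePoint e α t)) := by
  have h₁ : z + circlePoint e α (t + φ) =
      hyperplaneReflection β (z + circlePoint e α (φ - t)) := by
    rw [P.reflection_right]; ring_nf
  have hmem : φ - t ∈ Set.Icc 0 φ := ⟨by linarith [ht.2], by linarith [ht.1]⟩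
  have := nonempty_boundary P.left_mem
  rw [dist_comm, h₁, dist_mk_mk_reflection hR P.right_mem (P.circlePoint_mem ht)
    (P.circlePoint_mem hmem)]
  refine le_ciInf fun ⟨⟨w, hwC⟩, hw⟩ => ?_
  simp only
  obtain ⟨γ, hγ, hγw⟩ := exists_inner_eq_zero_of_mem_frontier hw
  have hwall : ∀ p q : V, dist p (hyperplaneReflection γ q) ≤ dist p w + dist q w := fun p q => by
    refine (dist_triangle _ w _).trans_eq ?_
    rw [dist_comm q w, ← (hyperplaneReflection γ).dist_map w q,
      hyperplaneReflection_apply_eq_self hγw]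
  by_cases hγα : γ = α
  · refine le_trans ?_ (hwall _ _)
    rw [hγα, P.reflection_left, neg_sub]
    have := P.dist_angle (t - φ)
    rw [sub_add_cancel] at this
    exact this.ge
  by_cases hγβ : γ = β
  · refine le_trans ?_ (hwall _ _)
    rw [hγβ, ← h₁, dist_comm, P.dist_angle]
  · have h₂ := P.two_le_inner_other hγ hγα hγβ t
    have h₃ := real_inner_le_norm γ (z + circlePoint e α t - w)
    rw [inner_sub_right, hγw, hγ.1.1, one_mul, ← dist_eq_norm] at h₃
    linarith [Real.sin_le_one (φ / 2), dist_nonneg (x := z + circlePoint e α (φ - t)) (y := w)]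

omit [FiniteDimensional ℝ V] [Finite R] in
theorem mk_add_two_mul_angle [FiniteDimensional ℝ V] (t : ℝ) :
    OrbitSpace.mk (alternatingSubgroup R) (z + circlePoint e α (t + 2 * φ)) =
      OrbitSpace.mk (alternatingSubgroup R) (z + circlePoint e α t) := by
  have hα0 : α ≠ 0 := fun h => by simpa [h] using P.left_mem.1.1
  have h₁ := hyperplaneReflection_mul_mem_alternatingSubgroup P.right_mem.1 P.left_mem.1.2
    (hyperplaneReflection_notMem_alternatingSubgroup hα0)
  have h₂ := P.rotation_pow 1 t
  rw [pow_one, Nat.cast_one, mul_one] at h₂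
  rw [← h₂]
  exact OrbitSpace.mk_smul (⟨_, h₁⟩ : alternatingSubgroup R) (z + circlePoint e α t)

theorem le_dist_mk_of_nonneg (hR : IsReflectionGroup R) {t : ℝ} (ht : 0 ≤ t) :
    2 * Real.sin (φ / 2) ≤
      dist (OrbitSpace.mk (alternatingSubgroup R) (z + circlePoint e α (t + φ)))
        (OrbitSpace.mk (alternatingSubgroup R) (z + circlePoint e α t)) := by
  have hφ := P.angle_pos
  have key : ∀ k : ℕ, ∀ r ∈ Set.Icc 0 φ, 2 * Real.sin (φ / 2) ≤
      dist (OrbitSpace.mk (alternatingSubgroup R) (z + circlePoint e α (r + k * φ + φ)))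
        (OrbitSpace.mk (alternatingSubgroup R) (z + circlePoint e α (r + k * φ))) := by
    intro k r hr
    induction k with
    | zero => simpa using P.le_dist_mk hR hr
    | succ k ih =>
      -- By the period 2φ, a pair of opposite points shifted by φ is the same pair swapped.
      rw [dist_comm, ← P.mk_add_two_mul_angle (r + k * φ)] at ih
      refine ih.trans_eq ?_
      push_cast
      ring_nf
  have h := key ⌊t / φ⌋₊ (t - ⌊t / φ⌋₊ * φ) ⟨?_, ?_⟩
  · rwa [sub_add_cancel] at h
  · have := Nat.floor_le (div_nonneg ht hφ.le)
    rw [le_div_iff₀ hφ] at this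
    linarith
  · have := (Nat.lt_floor_add_one (t / φ)).le
    rw [div_le_iff₀ hφ] at this
    linarith

/-- The maps from the orbit space to inner product spaces have distortion at least that of the
boundary circle of a small cone. -/
theorem mul_sin_mul_le (hR : IsReflectionGroup R) {n : ℕ} (hn : 0 < n) (hφ : φ = Real.pi / n)
    {H : Type*} [NormedAddCommGroup H] [InnerProductSpace ℝ H]
    {F : OrbitSpace (alternatingSubgroup R) V → H} {a b : ℝ} (ha : 0 < a) (hb : 0 ≤ b)
    (hFa : ∀ x y, a * dist x y ≤ dist (F x) (F y)) (hFb : ∀ x y, dist (F x) (F y) ≤ b * dist x y) :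
    n * Real.sin (Real.pi / (2 * n)) * a ≤ b := by
  have hπ := Real.pi_pos
  have hn0 : (0 : ℝ) < n := Nat.cast_pos.2 hn
  have hφ0 := P.angle_pos
  have hhalf : φ / 2 = Real.pi / (2 * n) := by rw [hφ]; field_simp
  have hsin := P.sin_angle_half_pos
  have key : ∀ M : ℕ, 0 < M →
      n * Real.sin (Real.pi / (2 * n)) * a * Real.sinc (Real.pi / 2 / M) ≤ b := by
    intro M hM
    have hM0 : (0 : ℝ) < M := Nat.cast_pos.2 hM
    -- The 2M points at angular steps φ/M run once around the closed curve of period 2φ. Arc length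
    -- bounds the edges, and points M steps apart are opposite.
    have h := sin_mul_le_of_closed_polygon (f := fun i : ℕ => F (OrbitSpace.mk _
      (z + circlePoint e α (i * (φ / M))))) hM (δ := b * (φ / M)) (D := a * (2 * Real.sin (φ / 2)))
      (fun i => ?_) (by positivity) (fun i => ?_) fun i => ?_
    · rw [Real.sinc_of_ne_zero (by positivity), ← hhalf]
      rw [show Real.pi / (2 * M) = Real.pi / 2 / M by field_simp, hφ] at h
      rw [hφ]
      set s := Real.sin (Real.pi / 2 / M)
      set r := Real.sin (Real.pi / n / 2)
      have h₁ : n * r * a * (s / (Real.pi / 2 / M)) = (s * (a * (2 * r))) * (n * M / Real.pi) := by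
        field_simp
      rw [h₁]
      calc _ ≤ b * (Real.pi / n / M) * (n * M / Real.pi) := by gcongr
        _ = b := by field_simp
    · simp only
      rw [← P.mk_add_two_mul_angle (i * (φ / M))]
      congr 4
      push_cast
      field_simp
    · rw [← dist_eq_norm]
      refine (hFb _ _).trans (mul_le_mul_of_nonneg_left
        ((OrbitSpace.dist_mk_le _ _).trans ?_) hb)
      rw [P.dist_eq]
      have h₁ : (((i + 1 : ℕ) : ℝ) * (φ / M) - i * (φ / M)) / 2 = φ / M / 2 := by push_cast; ring
      have h₂ : 0 ≤ φ / M / 2 := by positivity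
      rw [h₁]
      have := Real.abs_sin_le_abs (x := φ / M / 2)
      rw [abs_of_nonneg h₂] at this
      linarith
    · rw [← dist_eq_norm]
      refine le_trans ?_ (hFa _ _)
      gcongr
      have h₁ : ((i + M : ℕ) : ℝ) * (φ / M) = i * (φ / M) + φ := by push_cast; field_simp
      rw [h₁]
      exact P.le_dist_mk_of_nonneg hR (by positivity)
  -- The discretization error is a factor `Real.sinc` of π/(2M), which tends to 1.
  have hlim : Filter.Tendsto (fun M : ℕ => n * Real.sin (Real.pi / (2 * n)) * a *
      Real.sinc (Real.pi / 2 / M)) Filter.atTop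
      (nhds (n * Real.sin (Real.pi / (2 * n)) * a * Real.sinc 0)) :=
    ((Real.continuous_sinc.tendsto 0).comp
      (tendsto_const_div_atTop_nhds_zero_nat (Real.pi / 2))).const_mul _
  rw [Real.sinc_zero, mul_one] at hlim
  exact le_of_tendsto hlim (Filter.eventually_atTop.2 ⟨1, fun M hM => key M hM⟩)

end SimplePair

end WeylChamber

/-! ### Entries of the Coxeter matrix and the lower bound -/

namespace WeylChamber

variable {V : Type*} [NormedAddCommGroup V] [InnerProductSpace ℝ V]
  {R : Subgroup (V ≃ₗᵢ[ℝ] V)} [Finite R] {C : WeylChamber R}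

omit [Finite R] in
theorem coxeterMatrix_apply (α β : C.simpleRoots) : C.coxeterMatrix α β =
    orderOf (hyperplaneReflection (α : V) * hyperplaneReflection (β : V)) := rfl

theorem coxeterMatrix_pos (α β : C.simpleRoots) : 0 < C.coxeterMatrix α β := by
  have h := isOfFinOrder_of_finite
    (⟨_, R.mul_mem α.2.1.2 β.2.1.2⟩ : R)
  rw [coxeterMatrix_apply, orderOf_pos_iff]
  exact R.subtype.isOfFinOrder h

theorem two_le_coxeterMatrix {α β : C.simpleRoots} (hne : α ≠ β) : 2 ≤ C.coxeterMatrix α β := by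
  have h₁ := coxeterMatrix_pos α β
  have h₂ := C.coxeterMatrix.off_diagonal α β hne
  have h₃ : C.coxeterMatrix α β ≠ 1 := h₂
  omega

theorem exists_isLargestCoxeterEntry (hne : C.simpleRoots.Nonempty) :
    ∃ n, C.IsLargestCoxeterEntry n := by
  have : Finite C.simpleRoots := finite_simpleRoots
  have hfin : {m | ∃ α β, C.coxeterMatrix α β = m}.Finite := by
    have h : {m | ∃ α β, C.coxeterMatrix α β = m} =
        Set.range fun p : C.simpleRoots × C.simpleRoots => C.coxeterMatrix p.1 p.2 := by
      ext m; simp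
    rw [h]
    exact Set.finite_range _
  obtain ⟨α, hα⟩ := hne
  obtain ⟨n, hn, hmax⟩ := Set.exists_max_image _ id hfin ⟨_, ⟨α, hα⟩, ⟨α, hα⟩, rfl⟩
  exact ⟨n, hn, fun m hm => hmax m hm⟩

/-- A reflection group with more than two elements has two simple roots. -/
theorem nontrivial_simpleRoots (hR : IsReflectionGroup R) (hcard : 2 < Nat.card R) :
    ∃ α β : C.simpleRoots, α ≠ β := by
  by_contra! hcon
  have hsub : (hyperplaneReflection '' C.simpleRoots).Subsingleton := by
    rintro _ ⟨α, hα, rfl⟩ _ ⟨β, hβ, rfl⟩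
    exact congrArg _ (congrArg Subtype.val (hcon ⟨α, hα⟩ ⟨β, hβ⟩))
  have hcl := closure_simpleRoots (C := C) hR
  rcases hsub.eq_empty_or_singleton with h | ⟨s, h⟩
  · rw [h, Subgroup.closure_empty] at hcl
    rw [← hcl, Subgroup.card_bot] at hcard
    omega
  · obtain ⟨α, -, hs⟩ : s ∈ hyperplaneReflection '' C.simpleRoots := by rw [h]; rfl
    rw [h, ← Subgroup.zpowers_eq_closure] at hcl
    rw [← hcl, Nat.card_zpowers] at hcard
    have := orderOf_le_of_pow_eq_one two_pos
      (show s ^ 2 = 1 by rw [sq, ← hs, hyperplaneReflection_mul_self])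
    omega

theorem IsLargestCoxeterEntry.two_le {n : ℕ} (hn : C.IsLargestCoxeterEntry n)
    (hR : IsReflectionGroup R) (hcard : 2 < Nat.card R) : 2 ≤ n := by
  obtain ⟨α, β, hne⟩ := nontrivial_simpleRoots (C := C) hR hcard
  exact (two_le_coxeterMatrix hne).trans (hn.2 ⟨α, β, rfl⟩)

/-- A walk in the Coxeter graph between two different simple roots has a first edge, whose entry is
neither 1 nor 2. -/
theorem IsLargestCoxeterEntry.three_le {n : ℕ} (hn : C.IsLargestCoxeterEntry n)
    (hR : IsReflectionGroup R) (hcard : 2 < Nat.card R) (hirr : C.IsIrreducible) : 3 ≤ n := by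
  obtain ⟨α, β, hne⟩ := nontrivial_simpleRoots (C := C) hR hcard
  obtain ⟨p⟩ := hirr.preconnected α β
  cases p with
  | nil => exact absurd rfl hne
  | @cons _ γ _ h _ =>
    have h₁ := two_le_coxeterMatrix h.1
    have h₂ := h.2
    have h₃ : C.coxeterMatrix α γ ≤ n := hn.2 ⟨_, _, rfl⟩
    omega

theorem IsLargestCoxeterEntry.le_euclideanDistortion {V : Type u} [NormedAddCommGroup V]
    [InnerProductSpace ℝ V] [FiniteDimensional ℝ V] {R : Subgroup (V ≃ₗᵢ[ℝ] V)} [Finite R]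
    {C : WeylChamber R} {n : ℕ} (hn : C.IsLargestCoxeterEntry n) (hR : IsReflectionGroup R) :
    ENNReal.ofReal (n * Real.sin (Real.pi / (2 * n))) ≤
      euclideanDistortion (OrbitSpace (alternatingSubgroup R) V) := by
  obtain ⟨⟨α, β, hαβ⟩, -⟩ := hn
  have hdist : 0 < dist (OrbitSpace.mk (alternatingSubgroup R) C.basePoint)
      (OrbitSpace.mk (alternatingSubgroup R) 0) := by
    rw [dist_mk_mk hR C.basePoint_mem C.zero_mem, dist_zero_right, norm_pos_iff]
    intro h₀
    have h₁ := inner_basePoint_pos (simpleRoots_subset α.2)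
    rw [h₀, inner_zero_right] at h₁
    exact lt_irrefl _ h₁
  refine ofReal_le_euclideanDistortion hdist fun H _ _ F a b ha hb hFa hFb => ?_
  -- A largest entry on the diagonal means n = 1. The bound is then a ≤ b, read off from one pair of
  -- points at positive distance.
  by_cases hne : α = β
  · have h₁ : n = 1 := by rw [← hαβ, hne]; exact C.coxeterMatrix.diagonal β
    rw [h₁, Nat.cast_one, mul_one, Real.sin_pi_div_two, mul_one, one_mul]
    exact le_of_mul_le_mul_right ((hFa _ _).trans (hFb _ _)) hdist
  -- The roots are swapped because the rotation of a simple pair applies the reflection in its first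
  -- root first.
  · obtain ⟨e, z, φ, P⟩ := exists_simplePair β.2 α.2 (Subtype.coe_ne_coe.2 (Ne.symm hne))
    have h₂ : 2 ≤ n := hαβ ▸ two_le_coxeterMatrix hne
    exact P.mul_sin_mul_le hR (by omega) (P.angle_eq hR h₂ hαβ) ha hb hFa hFb

end WeylChamber

theorem mainTheorem9 {V : Type*} [NormedAddCommGroup V] [InnerProductSpace ℝ V]
    [FiniteDimensional ℝ V] (R : Subgroup (V ≃ₗᵢ[ℝ] V)) [Finite R]
    (hR : IsReflectionGroup R) (C : WeylChamber R) :
    euclideanDistortion (OrbitSpace (alternatingSubgroup R) V) ≤ 2 ∧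
    (R ≠ ⊥ →
      (∃ n : ℕ, C.IsLargestCoxeterEntry n ∧
        ENNReal.ofReal (n * Real.sin (Real.pi / (2 * n))) ≤
          euclideanDistortion (OrbitSpace (alternatingSubgroup R) V) ∧
        (2 < Nat.card R → √2 ≤ n * Real.sin (Real.pi / (2 * n))) ∧
        (2 < Nat.card R → C.IsIrreducible →
          3 / 2 ≤ n * Real.sin (Real.pi / (2 * n)))) ∧
      ∃ _ : Nonempty C.boundary,
        Nonempty (OrbitSpace (alternatingSubgroup R) V ≃ᵢ GluedDouble C.boundary)) := by
  refine ⟨C.euclideanDistortion_le_two hR, fun hne => ?_⟩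
  obtain ⟨α, hα⟩ := WeylChamber.nonempty_simpleRoots (C := C) hR hne
  obtain ⟨n, hn⟩ := WeylChamber.exists_isLargestCoxeterEntry ⟨α, hα⟩
  have hboundary := WeylChamber.nonempty_boundary hα
  refine ⟨⟨n, hn, hn.le_euclideanDistortion hR, fun hcard => ?_, fun hcard hirr => ?_⟩, hboundary,
    WeylChamber.nonempty_isometryEquiv_gluedDouble hR hα⟩
  -- By monotonicity only the least possible n matters: n = 2 here, n = 3 in the irreducible case.
  · refine le_trans ?_ (mul_sin_pi_div_mono two_pos (hn.two_le hR hcard))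
    rw [show Real.pi / (2 * (2 : ℕ)) = Real.pi / 4 by norm_num, Real.sin_pi_div_four]
    exact le_of_eq (by push_cast; ring)
  · refine le_trans ?_ (mul_sin_pi_div_mono three_pos (hn.three_le hR hcard hirr))
    rw [show Real.pi / (2 * (3 : ℕ)) = Real.pi / 6 by norm_num, Real.sin_pi_div_six]
    norm_num
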